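/- Let $\mathcal X,\mathcal Y_1,\mathcal Y_2$ be finite sets and let $P(y_1,y_2\mid x)$ be a discrete memoryless broadcast channel with input alphabet $\mathcal X$ and output alphabets $\mathcal Y_1$ (receiver 1) and $\mathcal Y_2$ (receiver 2). All entropies and mutual informations are in bits. For $M_1,M_2,n\ge 1$, an $(M_1,M_2,n)$ code consists of a stochastic encoder, i.e. a probability distribution $f(\cdot\mid w_1,w_2)$ on $\mathcal X^n$ for each $(w_1,w_2)\in\{1,\dots,M_1\}\times\{1,\dots,M_2\}$, and of two decoders $\phi_t:\mathcal Y_t^n\to\{1,\dots,M_t\}$, $t=1,2$. The messages $W_1,W_2$ are independent and uniformly distributed; given $(W_1,W_2)=(w_1,w_2)$ the input $\mathbf X$ has distribution $f(\cdot\mid w_1,w_2)$, and given $\mathbf X=\mathbf x$ the outputs $(\mathbf Y_1,\mathbf Y_2)$ have distribution $\prod_{i=1}^n P(y_{1,i},y_{2,i}\mid x_i)$, independently of the messages. A pair of real numbers $(R_1,R_2)$ is *achievable* (with confidential messages) if for every $\varepsilon>0$ there are $M_1,M_2,n\ge1$ and an $(M_1,M_2,n)$ code such that $$M_t\ge 2^{nR_t}\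 (t=1,2),\qquad \max_{t=1,2}\Pr[\phi_t(\mathbf Y_t)\ne W_t]\le\varepsilon,$$ $$nR_1-H(W_1\mid\mathbf Y_2)\le n\varepsilon,\qquad nR_2-H(W_2\mid\mathbf Y_1)\le n\varepsilon .$$ Let $\pi_{\rm BC}$ be the class of joint distributions of random variables $(U,V_1,V_2,X,Y_1,Y_2)$, where $U,V_1,V_2$ take values in arbitrary finite sets and $X,Y_1,Y_2$ in $\mathcal X,\mathcal Y_1,\mathcal Y_2$, that factor as $$P(u)\,P(v_1,v_2\mid u)\,P(x\mid v_1,v_2)\,P(y_1,y_2\mid x),$$ the last factor being the given channel. **Corollary.** If some distribution in $\pi_{\rm BC}$ satisfies $$I(V_1;Y_1\mid U)>I(V_1;Y_2,V_2\mid U)\quad\text{and}\quad I(V_2;Y_2\mid U)>I(V_2;Y_1,V_1\mid U),$$ then there are $R_1>0$ and $R_2>0$ such that the pair $(R_1,R_2)$ is achievable with confidential messages; that is, both receivers simultaneously achieve strictly positive secrecy rates. -/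

import Mathlib

namespace BCCM

noncomputable section

/-! ### Information measures of finite random variables

A probability distribution on a finite set `Ω` is given by its mass function `p : Ω → ℝ`, and a
random variable is a function on `Ω`.  All logarithms are to base 2. -/

/-- The probability `P[X = a]`. -/
def law {Ω A : Type*} [Fintype Ω] (p : Ω → ℝ) (X : Ω → A) (a : A) : ℝ :=
  open Classical in ∑ ω, if X ω = a then p ω else 0

/-- Conditional entropy in bits: `H(X | Y) = -∑_{a,b} P(a,b) log₂ (P(a,b) / P(b))`.  The terms with
`P(a,b) = 0` vanish, which is the convention `0 log 0 = 0`. -/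
def condEntropy {Ω A B : Type*} [Fintype Ω] [Fintype A] [Fintype B]
    (p : Ω → ℝ) (X : Ω → A) (Y : Ω → B) : ℝ :=
  -∑ a, ∑ b, law p (fun ω => (X ω, Y ω)) (a, b) *
    Real.logb 2 (law p (fun ω => (X ω, Y ω)) (a, b) / law p Y b)

/-- Conditional mutual information in bits: `I(X; Y | Z) = H(X | Z) - H(X | Y, Z)`. -/
def condMutualInfo {Ω A B C : Type*} [Fintype Ω] [Fintype A] [Fintype B] [Fintype C]
    (p : Ω → ℝ) (X : Ω → A) (Y : Ω → B) (Z : Ω → C) : ℝ :=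
  condEntropy p X Z - condEntropy p X (fun ω => (Y ω, Z ω))

/-! ### The class of input distributions with auxiliary variables

A discrete memoryless broadcast channel is a stochastic matrix `W : 𝒳 → stdSimplex ℝ (𝒴₁ × 𝒴₂)`,
with `W x (y₁, y₂) = P(y₁, y₂ | x)`. -/

section Class

variable {𝒰 𝒱₁ 𝒱₂ 𝒳 𝒴₁ 𝒴₂ : Type*} [Fintype 𝒰] [Fintype 𝒱₁] [Fintype 𝒱₂] [Fintype 𝒳]
  [Fintype 𝒴₁] [Fintype 𝒴₂]

/-- The class of joint distributions `P(u, v₁, v₂, x, y₁, y₂)` that factor as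
`P(u) P(v₁, v₂ | u) P(x | v₁, v₂) P(y₁, y₂ | x)`, the last factor being the given channel. -/
def piBC (W : 𝒳 → stdSimplex ℝ (𝒴₁ × 𝒴₂)) : Set (𝒰 × 𝒱₁ × 𝒱₂ × 𝒳 × 𝒴₁ × 𝒴₂ → ℝ) :=
  {P | ∃ (pU : stdSimplex ℝ 𝒰) (pV : 𝒰 → stdSimplex ℝ (𝒱₁ × 𝒱₂))
      (pX : 𝒱₁ × 𝒱₂ → stdSimplex ℝ 𝒳),
      ∀ u v₁ v₂ x y₁ y₂,
        P (u, v₁, v₂, x, y₁, y₂) = pU u * pV u (v₁, v₂) * pX (v₁, v₂) x * W x (y₁, y₂)}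

end Class

/-- The random variable `U`. -/
def rvU {𝒰 𝒱₁ 𝒱₂ 𝒳 𝒴₁ 𝒴₂ : Type*} (ω : 𝒰 × 𝒱₁ × 𝒱₂ × 𝒳 × 𝒴₁ × 𝒴₂) : 𝒰 := ω.1
/-- The random variable `V₁`. -/
def rvV₁ {𝒰 𝒱₁ 𝒱₂ 𝒳 𝒴₁ 𝒴₂ : Type*} (ω : 𝒰 × 𝒱₁ × 𝒱₂ × 𝒳 × 𝒴₁ × 𝒴₂) : 𝒱₁ := ω.2.1
/-- The random variable `V₂`. -/
def rvV₂ {𝒰 𝒱₁ 𝒱₂ 𝒳 𝒴₁ 𝒴₂ : Type*} (ω : 𝒰 × 𝒱₁ × 𝒱₂ × 𝒳 × 𝒴₁ × 𝒴₂) : 𝒱₂ := ω.2.2.1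
/-- The random variable `Y₁`. -/
def rvY₁ {𝒰 𝒱₁ 𝒱₂ 𝒳 𝒴₁ 𝒴₂ : Type*} (ω : 𝒰 × 𝒱₁ × 𝒱₂ × 𝒳 × 𝒴₁ × 𝒴₂) : 𝒴₁ := ω.2.2.2.2.1
/-- The random variable `Y₂`. -/
def rvY₂ {𝒰 𝒱₁ 𝒱₂ 𝒳 𝒴₁ 𝒴₂ : Type*} (ω : 𝒰 × 𝒱₁ × 𝒱₂ × 𝒳 × 𝒴₁ × 𝒴₂) : 𝒴₂ := ω.2.2.2.2.2

/-! ### Codes and achievable rates -/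

/-- A code with `M₁` and `M₂` messages and block length `n`: a stochastic encoder
`f(x | w₁, w₂)`, which is a distribution on `𝒳ⁿ` for each message pair, and two decoders. -/
structure Code (𝒳 𝒴₁ 𝒴₂ : Type*) [Fintype 𝒳] (M₁ M₂ n : ℕ) where
  enc : Fin M₁ → Fin M₂ → stdSimplex ℝ (Fin n → 𝒳)
  dec₁ : (Fin n → 𝒴₁) → Fin M₁
  dec₂ : (Fin n → 𝒴₂) → Fin M₂

section Achievable

variable {𝒳 𝒴₁ 𝒴₂ : Type*} [Fintype 𝒳] [Fintype 𝒴₁] [Fintype 𝒴₂] {M₁ M₂ n : ℕ}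

/-- The memoryless extension `P(y₁, y₂ | x) = ∏ᵢ P(y₁ᵢ, y₂ᵢ | xᵢ)` of the channel. -/
def blockChannel (W : 𝒳 → stdSimplex ℝ (𝒴₁ × 𝒴₂)) (x : Fin n → 𝒳) (y₁ : Fin n → 𝒴₁)
    (y₂ : Fin n → 𝒴₂) : ℝ :=
  ∏ i, W (x i) (y₁ i, y₂ i)

/-- The probability that the outputs are `(y₁, y₂)` given that the messages `(w₁, w₂)` are sent. -/
def outputProb (W : 𝒳 → stdSimplex ℝ (𝒴₁ × 𝒴₂)) (c : Code 𝒳 𝒴₁ 𝒴₂ M₁ M₂ n)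
    (w₁ : Fin M₁) (w₂ : Fin M₂) (y₁ : Fin n → 𝒴₁) (y₂ : Fin n → 𝒴₂) : ℝ :=
  ∑ x, c.enc w₁ w₂ x * blockChannel W x y₁ y₂

/-- The joint distribution of the messages and the outputs `((W₁, W₂), (Y₁, Y₂))`: the messages are
independent and uniformly distributed. -/
def codeDist (W : 𝒳 → stdSimplex ℝ (𝒴₁ × 𝒴₂)) (c : Code 𝒳 𝒴₁ 𝒴₂ M₁ M₂ n) :
    (Fin M₁ × Fin M₂) × ((Fin n → 𝒴₁) × (Fin n → 𝒴₂)) → ℝ :=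
  fun ω => 1 / ((M₁ : ℝ) * M₂) * outputProb W c ω.1.1 ω.1.2 ω.2.1 ω.2.2

/-- The average error probability at receiver 1. -/
def errorProb₁ (W : 𝒳 → stdSimplex ℝ (𝒴₁ × 𝒴₂)) (c : Code 𝒳 𝒴₁ 𝒴₂ M₁ M₂ n) : ℝ :=
  ∑ w₁, ∑ w₂, 1 / ((M₁ : ℝ) * M₂) *
    ∑ y₁, ∑ y₂, if c.dec₁ y₁ ≠ w₁ then outputProb W c w₁ w₂ y₁ y₂ else 0

/-- The average error probability at receiver 2. -/
def errorProb₂ (W : 𝒳 → stdSimplex ℝ (𝒴₁ × 𝒴₂)) (c : Code 𝒳 𝒴₁ 𝒴₂ M₁ M₂ n) : ℝ :=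
  ∑ w₁, ∑ w₂, 1 / ((M₁ : ℝ) * M₂) *
    ∑ y₁, ∑ y₂, if c.dec₂ y₂ ≠ w₂ then outputProb W c w₁ w₂ y₁ y₂ else 0

/-- The error probability of a code: the larger of the two average error probabilities. -/
def errorProb (W : 𝒳 → stdSimplex ℝ (𝒴₁ × 𝒴₂)) (c : Code 𝒳 𝒴₁ 𝒴₂ M₁ M₂ n) : ℝ :=
  max (errorProb₁ W c) (errorProb₂ W c)

/-- The equivocation `H(W₁ | Y₂)` of message 1 at receiver 2. -/
def equivocation₁ (W : 𝒳 → stdSimplex ℝ (𝒴₁ × 𝒴₂)) (c : Code 𝒳 𝒴₁ 𝒴₂ M₁ M₂ n) : ℝ :=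
  condEntropy (codeDist W c) (fun ω => ω.1.1) (fun ω => ω.2.2)

/-- The equivocation `H(W₂ | Y₁)` of message 2 at receiver 1. -/
def equivocation₂ (W : 𝒳 → stdSimplex ℝ (𝒴₁ × 𝒴₂)) (c : Code 𝒳 𝒴₁ 𝒴₂ M₁ M₂ n) : ℝ :=
  condEntropy (codeDist W c) (fun ω => ω.1.2) (fun ω => ω.2.1)

/-- The rate pair `(R₁, R₂)` is achievable for the broadcast channel with confidential messages:
for every `ε > 0` there is a code of some positive block length that meets the rate, reliability
and security requirements. -/
def Achievable (W : 𝒳 → stdSimplex ℝ (𝒴₁ × 𝒴₂)) (R₁ R₂ : ℝ) : Prop :=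
  ∀ ε : ℝ, 0 < ε → ∃ (M₁ M₂ n : ℕ) (c : Code 𝒳 𝒴₁ 𝒴₂ M₁ M₂ n),
    0 < n ∧
    (2 : ℝ) ^ ((n : ℝ) * R₁) ≤ M₁ ∧ (2 : ℝ) ^ ((n : ℝ) * R₂) ≤ M₂ ∧
    errorProb W c ≤ ε ∧
    n * R₁ - equivocation₁ W c ≤ n * ε ∧
    n * R₂ - equivocation₂ W c ≤ n * ε

end Achievable

end

end BCCM

namespace BCCM

/-!
### Outline

For some value of `U`, either receiver is a wiretap receiver with a larger mutual information than
the other one.  Random coding with soft covering gives wiretap codes of positive rate, whose error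
and total leakage tend to zero, for either receiver, and the two codes are used one after the other.
-/

/-! ### Elementary inequalities -/

/-! Only positivity of the two rates is claimed, so no joint coding of the two messages is needed:
each message gets its own wiretap code, and the two codes occupy different halves of the block.

Dropping `V₂` from the eavesdropper's side of the first hypothesis only lowers that mutual
information, so I(V₁;Y₁|U) > I(V₁;Y₂|U). Both sides are averages over U, hence the strict inequality
persists for some fixed value u (`exists_channelInfo_lt`). There `V₂` is averaged out into a prefix
channel from `V₁` to X (`exists_conditional_input`). This is a wiretap channel whose legitimate
receiver has the larger mutual information. The second hypothesis does the same with the receivers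
exchanged.

With I > J these informations in nats, draw M·K codewords independently, K ≈ exp(n(J+δ)) for each of
M ≈ exp(nδ) messages, and send a uniformly chosen codeword of the message. The total rate J+2δ is
below I, so threshold decoding succeeds (`codebookMean_threshold_le`). The randomisation rate
exceeds J, so the eavesdropper's output given a message is close in divergence to the i.i.d. output
law (`codebookMean_divergence_le`). Exponential moments of the information density make both
quantities decay geometrically, and the mean of their nonnegative sum yields one codebook good for
both (`exists_oneShot_code`, `exists_block_code`).

The divergence bounds the leakage: comparing with any fixed law instead of the true output marginal
only increases it, so the equivocation is at least log M minus the divergence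
(`condEntropy_ge_of_law_eq`). The other half of the block is independent of the message and reveals
nothing. -/

theorem sub_le_mul_log_div {f g : ℝ} (hf : 0 ≤ f) (hg : 0 ≤ g) (h : g = 0 → f = 0) :
    f - g ≤ f * Real.log (f / g) := by
  rcases hf.eq_or_lt with rfl | hf'
  · simpa using hg
  have hg' : 0 < g := lt_of_le_of_ne hg fun h0 => hf'.ne' (h h0.symm)
  have h1 := Real.log_le_sub_one_of_pos (div_pos hg' hf')
  have h2 : Real.log (f / g) = -Real.log (g / f) := by rw [← Real.log_inv, inv_div]
  have h3 : f * (g / f) = g := by field_simp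
  -- Multiplying `log (g / f) ≤ g / f - 1` by `f` gives the claim.
  rw [h2]
  nlinarith

/-- Gibbs' inequality. -/
theorem sum_mul_log_div_nonneg {ι : Type*} (s : Finset ι) {f g : ι → ℝ} (hf : ∀ i ∈ s, 0 ≤ f i)
    (hg : ∀ i ∈ s, 0 ≤ g i) (h : ∀ i ∈ s, g i = 0 → f i = 0)
    (hsum : ∑ i ∈ s, g i ≤ ∑ i ∈ s, f i) : 0 ≤ ∑ i ∈ s, f i * Real.log (f i / g i) :=
  calc 0 ≤ ∑ i ∈ s, (f i - g i) := by rw [Finset.sum_sub_distrib]; linarith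
    _ ≤ _ := Finset.sum_le_sum fun i hi => sub_le_mul_log_div (hf i hi) (hg i hi) (h i hi)

/-- Trades a logarithm for a power, which factorises over the letters of a block. It comes from
subadditivity of `t ↦ t ^ s` for `s ≤ 1` and `log x ≤ x - 1`. -/
theorem log_one_add_le_rpow_div {t s : ℝ} (ht : 0 ≤ t) (hs : 0 < s) (hs1 : s ≤ 1) :
    Real.log (1 + t) ≤ t ^ s / s := by
  have h1 : (1 + t) ^ s ≤ 1 + t ^ s := by
    simpa using Real.rpow_add_le_add_rpow zero_le_one ht hs.le hs1
  have h2 : s * Real.log (1 + t) = Real.log ((1 + t) ^ s) :=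
    (Real.log_rpow (by positivity) s).symm
  have h3 : Real.log ((1 + t) ^ s) ≤ t ^ s := by
    have := Real.log_le_sub_one_of_pos (show 0 < (1 + t) ^ s by positivity)
    linarith
  rw [le_div_iff₀ hs]
  linarith

/-- The tangent line bound for the logarithm at `1 + a`. -/
theorem log_add_le_tangent {a S : ℝ} (ha : 0 ≤ a) (h : 0 < a + S) :
    Real.log (a + S) ≤ Real.log (1 + a) + (S - 1) / (1 + a) := by
  have h1 : 0 < 1 + a := by positivity
  have h2 := Real.log_le_sub_one_of_pos (div_pos h h1)
  rw [Real.log_div h.ne' h1.ne'] at h2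
  have h3 : (a + S) / (1 + a) - 1 = (S - 1) / (1 + a) := by field_simp; ring
  linarith

/-- A finite random variable with negative mean has an exponential moment below one. -/
theorem exists_sum_mul_exp_lt_one {ι : Type*} (t : Finset ι) (m c : ι → ℝ)
    (hm : ∑ j ∈ t, m j = 1) (hc : ∑ j ∈ t, m j * c j < 0) :
    ∃ s : ℝ, 0 < s ∧ s ≤ 1 ∧ ∑ j ∈ t, m j * Real.exp (s * c j) < 1 := by
  -- The moment generating function is 1 at 0 and its derivative there is the negative mean, so it
  -- drops below 1 immediately to the right of 0.
  have hd : HasDerivAt (fun s : ℝ => ∑ j ∈ t, m j * Real.exp (s * c j))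
      (∑ j ∈ t, m j * c j) 0 := by
    refine HasDerivAt.fun_sum fun j _ => ?_
    have := (((hasDerivAt_id (0 : ℝ)).mul_const (c j)).exp).const_mul (m j)
    simpa using this
  have h0 : ∀ᶠ s in nhdsWithin (0 : ℝ) (Set.Ioi 0),
      ∑ j ∈ t, m j * Real.exp (s * c j) < 1 := by
    have h1 := hd.hasDerivWithinAt (s := Set.Ioi (0 : ℝ))
    rw [hasDerivWithinAt_iff_tendsto_slope' (by simp)] at h1
    filter_upwards [h1.eventually_lt_const hc, self_mem_nhdsWithin] with s hs hs0
    have hs0' : 0 < s := hs0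
    rw [slope_def_field, div_lt_iff₀ (by simpa using hs0')] at hs
    simp only [zero_mul, Real.exp_zero, mul_one, hm] at hs
    linarith
  have h2 : ∀ᶠ s in nhdsWithin (0 : ℝ) (Set.Ioi 0), s ∈ Set.Ioc (0 : ℝ) 1 :=
    Ioc_mem_nhdsGT zero_lt_one
  obtain ⟨s, hs, hs'⟩ := (h0.and h2).exists
  exact ⟨s, hs'.1, hs'.2, hs⟩

/-! ### Random codebooks -/

section Codebook

variable {I X : Type*} [Fintype I] [DecidableEq I] [Fintype X]

/-- The mean of a function of a codebook whose codewords are drawn independently from `p`. -/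
def codebookMean (p : X → ℝ) (F : (I → X) → ℝ) : ℝ := ∑ c, (∏ i, p (c i)) * F c

variable {p : X → ℝ}

theorem sum_prod_eq_one (hp : ∑ x, p x = 1) : ∑ c : I → X, ∏ i, p (c i) = 1 := by
  rw [← Fintype.piFinset_univ, ← Finset.prod_univ_sum]
  simp [hp]

theorem codebookMean_eval (hp : ∑ x, p x = 1) (a : I) (F : X → ℝ) :
    codebookMean p (fun c : I → X => F (c a)) = ∑ x, p x * F x := by
  unfold codebookMean
  rw [← (Equiv.funSplitAt a X).symm.sum_comp, Fintype.sum_prod_type]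
  refine Finset.sum_congr rfl fun x _ => ?_
  have h : ∀ y : {j // j ≠ a} → X, (∏ i, p ((Equiv.funSplitAt a X).symm (x, y) i)) =
      p x * ∏ j, p (y j) := by
    intro y
    rw [Fintype.prod_eq_mul_prod_subtype_ne _ a]
    congr 1
    · simp [Equiv.funSplitAt, Equiv.piSplitAt]
    · refine Finset.prod_congr rfl fun j _ => ?_
      simp [Equiv.funSplitAt, Equiv.piSplitAt, j.2]
  simp only [h]
  simp only [Equiv.funSplitAt, Equiv.piSplitAt, Equiv.coe_fn_symm_mk, dite_true]
  simp_rw [mul_right_comm _ _ (F x)]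
  rw [← Finset.mul_sum, sum_prod_eq_one hp, mul_one]

/-- Pairwise independence of distinct codewords is all that the decoding and covering arguments use.
-/
theorem codebookMean_eval_pair (hp : ∑ x, p x = 1) {a b : I} (hab : a ≠ b) (F : X → X → ℝ) :
    codebookMean p (fun c : I → X => F (c a) (c b)) = ∑ x, ∑ x', p x * p x' * F x x' := by
  unfold codebookMean
  rw [← (Equiv.funSplitAt a X).symm.sum_comp, Fintype.sum_prod_type]
  refine Finset.sum_congr rfl fun x _ => ?_
  have h : ∀ y : {j // j ≠ a} → X, (∏ i, p ((Equiv.funSplitAt a X).symm (x, y) i)) =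
      p x * ∏ j, p (y j) := by
    intro y
    rw [Fintype.prod_eq_mul_prod_subtype_ne _ a]
    congr 1
    · simp [Equiv.funSplitAt, Equiv.piSplitAt]
    · refine Finset.prod_congr rfl fun j _ => ?_
      simp [Equiv.funSplitAt, Equiv.piSplitAt, j.2]
  simp only [h]
  simp only [Equiv.funSplitAt, Equiv.piSplitAt, Equiv.coe_fn_symm_mk, dite_true,
    hab.symm, dite_false]
  simp_rw [mul_assoc, ← Finset.mul_sum]
  exact congrArg (p x * ·) (codebookMean_eval hp (⟨b, hab.symm⟩ : {j // j ≠ a}) (F x))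

theorem codebookMean_add (F G : (I → X) → ℝ) :
    codebookMean p (fun c => F c + G c) = codebookMean p F + codebookMean p G := by
  simp [codebookMean, mul_add, Finset.sum_add_distrib]

theorem codebookMean_sum {ι : Type*} (s : Finset ι) (F : ι → (I → X) → ℝ) :
    codebookMean p (fun c => ∑ j ∈ s, F j c) = ∑ j ∈ s, codebookMean p (F j) := by
  simp only [codebookMean, Finset.mul_sum]
  rw [Finset.sum_comm]

theorem codebookMean_mul_left (r : ℝ) (F : (I → X) → ℝ) :
    codebookMean p (fun c => r * F c) = r * codebookMean p F := by
  simp only [codebookMean, Finset.mul_sum]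
  exact Finset.sum_congr rfl fun _ _ => by ring

/-- Codebooks with a letter of probability zero carry no weight. Excluding them matters: absolute
continuity with respect to the output law can fail there. -/
theorem codebookMean_mono (hp0 : ∀ x, 0 ≤ p x) {F G : (I → X) → ℝ}
    (h : ∀ c, (∀ i, p (c i) ≠ 0) → F c ≤ G c) : codebookMean p F ≤ codebookMean p G := by
  refine Finset.sum_le_sum fun c _ => ?_
  by_cases hc : ∀ i, p (c i) ≠ 0
  · exact mul_le_mul_of_nonneg_left (h c hc) (Finset.prod_nonneg fun i _ => hp0 _)
  · push Not at hc
    obtain ⟨i, hi⟩ := hc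
    rw [Finset.prod_eq_zero (Finset.mem_univ i) hi]
    simp

theorem codebookMean_average_le {M K : ℕ} (hM : 0 < M) (hK : 0 < K)
    {F : Fin M → Fin K → (I → X) → ℝ} {b : ℝ} (h : ∀ w k, codebookMean p (F w k) ≤ b) :
    codebookMean p (fun c => ∑ w, ∑ k, 1 / ((M : ℝ) * K) * F w k c) ≤ b := by
  have hM' : (0 : ℝ) < M := by exact_mod_cast hM
  have hK' : (0 : ℝ) < K := by exact_mod_cast hK
  calc codebookMean p (fun c => ∑ w, ∑ k, 1 / ((M : ℝ) * K) * F w k c)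
      = ∑ w, ∑ k, 1 / ((M : ℝ) * K) * codebookMean p (F w k) :=
        (codebookMean_sum _ _).trans (Finset.sum_congr rfl fun w _ =>
          (codebookMean_sum _ _).trans (Finset.sum_congr rfl fun k _ => codebookMean_mul_left _ _))
    _ ≤ ∑ w : Fin M, ∑ k : Fin K, 1 / ((M : ℝ) * K) * b :=
        Finset.sum_le_sum fun w _ => Finset.sum_le_sum fun k _ =>
          mul_le_mul_of_nonneg_left (h w k) (by positivity)
    _ = b := by
        simp only [Finset.sum_const, Finset.card_univ, Fintype.card_fin, nsmul_eq_mul]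
        field_simp

/-- The probabilistic method. The support condition on the chosen codebook is kept because it later
makes the code's output absolutely continuous with respect to the reference law. -/
theorem exists_le_of_codebookMean_le (hp0 : ∀ x, 0 ≤ p x) (hp : ∑ x, p x = 1)
    {F : (I → X) → ℝ} {η : ℝ} (h : codebookMean p F ≤ η) :
    ∃ c, (∀ i, p (c i) ≠ 0) ∧ F c ≤ η := by
  by_contra! hcon
  have h1 : ∑ c : I → X, (∏ i, p (c i)) * η < ∑ c : I → X, (∏ i, p (c i)) * F c := by
    refine Finset.sum_lt_sum (fun c _ => ?_) ?_
    · by_cases hc : ∀ i, p (c i) ≠ 0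
      · exact mul_le_mul_of_nonneg_left (hcon c hc).le (Finset.prod_nonneg fun i _ => hp0 _)
      · push Not at hc
        obtain ⟨i, hi⟩ := hc
        rw [Finset.prod_eq_zero (Finset.mem_univ i) hi]
        simp
    · obtain ⟨c, -, hc⟩ : ∃ c ∈ (Finset.univ : Finset (I → X)), (∏ i, p (c i)) ≠ 0 :=
        Finset.exists_ne_zero_of_sum_ne_zero (by rw [sum_prod_eq_one hp]; exact one_ne_zero)
      have hc' : ∀ i, p (c i) ≠ 0 := fun i => (Finset.prod_ne_zero_iff.1 hc) i (Finset.mem_univ i)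
      exact ⟨c, Finset.mem_univ c, mul_lt_mul_of_pos_left (hcon c hc')
        (lt_of_le_of_ne (Finset.prod_nonneg fun i _ => hp0 _) hc.symm)⟩
  rw [← Finset.sum_mul, sum_prod_eq_one hp, one_mul] at h1
  exact absurd h (not_le.2 h1)

end Codebook

/-! ### A one-shot wiretap code -/

section OneShot

variable {X Y Z : Type*} [Fintype X] [Fintype Y] [Fintype Z]

/-- The output distribution of the channel `A` with input distribution `p`. -/
def outputLaw (p : X → ℝ) (A : X → Y → ℝ) (y : Y) : ℝ := ∑ x, p x * A x y

variable {p : X → ℝ} {A : X → Y → ℝ}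

omit [Fintype Y] in
theorem outputLaw_nonneg (hp0 : ∀ x, 0 ≤ p x) (hA0 : ∀ x y, 0 ≤ A x y) (y : Y) :
    0 ≤ outputLaw p A y :=
  Finset.sum_nonneg fun x _ => mul_nonneg (hp0 x) (hA0 x y)

theorem sum_outputLaw (hp : ∑ x, p x = 1) (hA : ∀ x, ∑ y, A x y = 1) :
    ∑ y, outputLaw p A y = 1 := by
  unfold outputLaw
  rw [Finset.sum_comm]
  simp [← Finset.mul_sum, hA, hp]

omit [Fintype Y] in
theorem eq_zero_of_outputLaw_eq_zero (hp0 : ∀ x, 0 ≤ p x) (hA0 : ∀ x y, 0 ≤ A x y) {x : X} {y : Y}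
    (hx : p x ≠ 0) (h : outputLaw p A y = 0) : A x y = 0 := by
  have := (Finset.sum_eq_zero_iff_of_nonneg
    (fun x _ => mul_nonneg (hp0 x) (hA0 x y))).1 h x (Finset.mem_univ x)
  exact (mul_eq_zero.1 this).resolve_left hx

open Classical in
/-- The mean error probability of threshold decoding for a random codebook. -/
theorem codebookMean_threshold_le {I : Type*} [Fintype I] [DecidableEq I]
    (hp0 : ∀ x, 0 ≤ p x) (hp : ∑ x, p x = 1)
    (hA0 : ∀ x y, 0 ≤ A x y) (hA : ∀ x, ∑ y, A x y = 1) {T : ℝ} (hT : 0 < T)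
    (D : (I → X) → Y → I)
    (hD : ∀ c y i, T * outputLaw p A y < A (c i) y →
      (∀ j, j ≠ i → ¬ T * outputLaw p A y < A (c j) y) → D c y = i) (i : I) :
    codebookMean p (fun c : I → X => ∑ y, if D c y ≠ i then A (c i) y else 0) ≤
      (∑ x, p x * ∑ y, if T * outputLaw p A y < A x y then 0 else A x y) +
        Fintype.card I / T := by
  -- Union bound: a decoding error requires that the sent codeword fails the test or that another
  -- codeword passes it.
  have hpt : ∀ c : I → X, (∑ y, if D c y ≠ i then A (c i) y else 0) ≤
      (∑ y, if T * outputLaw p A y < A (c i) y then 0 else A (c i) y) +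
        ∑ j ∈ Finset.univ.erase i,
          ∑ y, if T * outputLaw p A y < A (c j) y then A (c i) y else 0 := by
    intro c
    rw [Finset.sum_comm (s := Finset.univ.erase i), ← Finset.sum_add_distrib]
    refine Finset.sum_le_sum fun y _ => ?_
    have hnn : ∀ j ∈ Finset.univ.erase i,
        0 ≤ if T * outputLaw p A y < A (c j) y then A (c i) y else 0 := by
      intro j _; split_ifs <;> simp [hA0]
    by_cases h1 : T * outputLaw p A y < A (c i) y
    · by_cases h2 : ∀ j, j ≠ i → ¬ T * outputLaw p A y < A (c j) y
      · rw [if_neg (not_not.2 (hD c y i h1 h2)), if_pos h1, zero_add]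
        exact Finset.sum_nonneg hnn
      · push Not at h2
        obtain ⟨j, hj, hj'⟩ := h2
        have := Finset.single_le_sum hnn (Finset.mem_erase.2 ⟨hj, Finset.mem_univ j⟩)
        rw [if_pos hj'] at this
        rw [if_pos h1, zero_add]
        refine le_trans ?_ this
        split_ifs <;> simp [hA0]
    · rw [if_neg h1]
      have := Finset.sum_nonneg hnn
      have h3 : (if D c y ≠ i then A (c i) y else 0) ≤ A (c i) y := by
        split_ifs <;> simp [hA0]
      linarith
  refine (codebookMean_mono hp0 fun c _ => hpt c).trans ?_
  rw [codebookMean_add, codebookMean_sum (s := Finset.univ.erase i)]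
  refine add_le_add ?_ ?_
  · exact (codebookMean_eval hp i
      (fun x => ∑ y, if T * outputLaw p A y < A x y then 0 else A x y)).le
  · have hj : ∀ j ∈ Finset.univ.erase i, codebookMean p (fun c : I → X =>
        ∑ y, if T * outputLaw p A y < A (c j) y then A (c i) y else 0) ≤ 1 / T := by
      intro j hj
      rw [codebookMean_eval_pair hp (Finset.ne_of_mem_erase hj) (fun x' x =>
        ∑ y, if T * outputLaw p A y < A x' y then A x y else 0)]
      calc ∑ x', ∑ x, p x' * p x * ∑ y, (if T * outputLaw p A y < A x' y then A x y else 0)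
          = ∑ x', p x' * ∑ y, if T * outputLaw p A y < A x' y then outputLaw p A y else 0 := by
            refine Finset.sum_congr rfl fun x' _ => ?_
            simp_rw [mul_assoc, ← Finset.mul_sum]
            congr 1
            simp_rw [Finset.mul_sum]
            rw [Finset.sum_comm]
            refine Finset.sum_congr rfl fun y _ => ?_
            split_ifs <;> simp [outputLaw]
        -- Change of measure: an output independent of the competitor follows the output law, which
        -- is below `A x' y / T` wherever the competitor passes the test.
        _ ≤ ∑ x', p x' * ∑ y, A x' y / T := by
            refine Finset.sum_le_sum fun x' _ => mul_le_mul_of_nonneg_left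
              (Finset.sum_le_sum fun y _ => ?_) (hp0 x')
            split_ifs with h
            · rw [le_div_iff₀ hT]; linarith
            · exact div_nonneg (hA0 _ _) hT.le
        _ = 1 / T := by
            simp_rw [← Finset.sum_div, hA]
            rw [← Finset.sum_mul, hp, one_mul]
    calc _ ≤ ∑ j ∈ Finset.univ.erase i, 1 / T := Finset.sum_le_sum hj
      _ ≤ ∑ j : I, 1 / T := Finset.sum_le_sum_of_subset_of_nonneg (Finset.erase_subset _ _)
          fun _ _ _ => by positivity
      _ = Fintype.card I / T := by simp [div_eq_mul_inv]

/-- The soft covering lemma: the mean divergence between the output distribution of a random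
codebook and that of the underlying input distribution. -/
theorem codebookMean_divergence_le {I : Type*} [Fintype I] [DecidableEq I]
    {B : X → Z → ℝ} (hp0 : ∀ x, 0 ≤ p x) (hp : ∑ x, p x = 1) (hB0 : ∀ x z, 0 ≤ B x z)
    {K : ℕ} (k : Fin K) (e : Fin K → I) (he : Function.Injective e) :
    codebookMean p (fun c : I → X => ∑ z, B (c (e k)) z *
        Real.log ((∑ j, B (c (e j)) z) / K / outputLaw p B z)) ≤
      ∑ x, p x * ∑ z, B x z * Real.log (1 + B x z / (K * outputLaw p B z)) := by
  have hK : (0 : ℝ) < K := by exact_mod_cast (Nat.zero_le _).trans_lt k.2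
  set r := outputLaw p B with hr
  have hr0 : ∀ z, 0 ≤ r z := outputLaw_nonneg hp0 hB0
  let a : X → Z → ℝ := fun x z => B x z / (K * r z)
  have ha : ∀ x z, 0 ≤ a x z := fun x z => div_nonneg (hB0 x z) (mul_nonneg hK.le (hr0 z))
  have hpt : ∀ c : I → X, (∀ i, p (c i) ≠ 0) →
      (∑ z, B (c (e k)) z * Real.log ((∑ j, B (c (e j)) z) / K / r z)) ≤
      (∑ z, (B (c (e k)) z * Real.log (1 + a (c (e k)) z) +
          (-1) * (B (c (e k)) z / (1 + a (c (e k)) z)))) +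
        ∑ j ∈ Finset.univ.erase k, ∑ z, B (c (e k)) z / (1 + a (c (e k)) z) * a (c (e j)) z := by
    intro c hc
    rw [Finset.sum_comm (s := Finset.univ.erase k), ← Finset.sum_add_distrib]
    refine Finset.sum_le_sum fun z _ => ?_
    rcases (hB0 (c (e k)) z).eq_or_lt with h0 | h0
    · simp [← h0]
    have hrz : 0 < r z := lt_of_le_of_ne (hr0 z) fun h =>
      h0.ne' (eq_zero_of_outputLaw_eq_zero hp0 hB0 (hc (e k)) h.symm)
    have h1 : (∑ j, B (c (e j)) z) / K / r z =
        a (c (e k)) z + ∑ j ∈ Finset.univ.erase k, a (c (e j)) z := by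
      rw [Finset.add_sum_erase _ (fun j => a (c (e j)) z) (Finset.mem_univ k), div_div,
        Finset.sum_div]
    have h2 : 0 < a (c (e k)) z := by positivity
    have h3 : 0 ≤ ∑ j ∈ Finset.univ.erase k, a (c (e j)) z := Finset.sum_nonneg fun _ _ => ha _ _
    -- The own term `a` stays inside the logarithm. The other terms of the row are independent of it
    -- with total mean at most 1, so linearising at `1 + a` leaves a correction whose mean is not
    -- positive.
    have h4 := mul_le_mul_of_nonneg_left (log_add_le_tangent h2.le (add_pos_of_pos_of_nonneg h2 h3))
      h0.le
    rw [h1, ← Finset.mul_sum]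
    refine h4.trans (le_of_eq ?_)
    ring
  refine (codebookMean_mono hp0 hpt).trans ?_
  rw [codebookMean_add, codebookMean_sum (s := Finset.univ.erase k),
    codebookMean_eval hp (e k) (fun x => ∑ z, (B x z * Real.log (1 + a x z) +
      (-1) * (B x z / (1 + a x z))))]
  have hw : ∀ x z, 0 ≤ B x z / (1 + a x z) := fun x z =>
    div_nonneg (hB0 x z) (by linarith [ha x z])
  have hj : ∀ j ∈ Finset.univ.erase k, codebookMean p (fun c : I → X =>
      ∑ z, B (c (e k)) z / (1 + a (c (e k)) z) * a (c (e j)) z) ≤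
      (∑ x, p x * ∑ z, B x z / (1 + a x z)) * (1 / K) := by
    intro j hj
    rw [codebookMean_eval_pair hp (he.ne (Finset.ne_of_mem_erase hj).symm) (fun x x' =>
      ∑ z, B x z / (1 + a x z) * a x' z), Finset.sum_mul]
    refine Finset.sum_le_sum fun x _ => ?_
    simp_rw [mul_assoc, ← Finset.mul_sum]
    refine mul_le_mul_of_nonneg_left ?_ (hp0 x)
    simp_rw [Finset.mul_sum]
    rw [Finset.sum_comm, Finset.sum_mul]
    refine Finset.sum_le_sum fun z _ => ?_
    have h5 : ∑ x', p x' * a x' z ≤ 1 / K := by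
      have : ∑ x', p x' * a x' z = r z / (K * r z) := by
        simp only [a, hr, outputLaw, Finset.sum_div, mul_div_assoc]
      rw [this]
      rcases (hr0 z).eq_or_lt with h | h
      · rw [← h]; simp
      · rw [div_le_div_iff₀ (by positivity) hK]; linarith
    calc ∑ x', p x' * (B x z / (1 + a x z) * a x' z)
        = B x z / (1 + a x z) * ∑ x', p x' * a x' z := by
          rw [Finset.mul_sum]; exact Finset.sum_congr rfl fun _ _ => by ring
      _ ≤ _ := mul_le_mul_of_nonneg_left h5 (hw x z)
  set S := ∑ x, p x * ∑ z, B x z / (1 + a x z) with hS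
  have hS0 : 0 ≤ S := Finset.sum_nonneg fun x _ => mul_nonneg (hp0 x)
    (Finset.sum_nonneg fun z _ => hw x z)
  have h6 : ∑ j ∈ Finset.univ.erase k, codebookMean p (fun c : I → X =>
      ∑ z, B (c (e k)) z / (1 + a (c (e k)) z) * a (c (e j)) z) ≤ S := by
    calc _ ≤ ∑ j ∈ Finset.univ.erase k, S * (1 / K) := Finset.sum_le_sum hj
      _ ≤ ∑ j : Fin K, S * (1 / K) := Finset.sum_le_sum_of_subset_of_nonneg
          (Finset.erase_subset _ _) fun _ _ _ => by positivity
      _ = S := by simp; field_simp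
  have h7 : ∑ x, p x * ∑ z, (B x z * Real.log (1 + a x z) + (-1) * (B x z / (1 + a x z))) =
      (∑ x, p x * ∑ z, B x z * Real.log (1 + a x z)) - S := by
    rw [hS, ← Finset.sum_sub_distrib]
    refine Finset.sum_congr rfl fun x _ => ?_
    rw [Finset.sum_add_distrib, ← Finset.mul_sum]
    ring
  rw [h7]
  linarith

open Classical in
/-- The one-shot wiretap coding theorem. -/
theorem exists_oneShot_code {B : X → Z → ℝ} (hp0 : ∀ x, 0 ≤ p x) (hp : ∑ x, p x = 1)
    (hA0 : ∀ x y, 0 ≤ A x y) (hA : ∀ x, ∑ y, A x y = 1)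
    (hB0 : ∀ x z, 0 ≤ B x z) (hB : ∀ x, ∑ z, B x z = 1) {T : ℝ} (hT : 0 < T)
    {M K : ℕ} (hM : 0 < M) (hK : 0 < K) {η : ℝ}
    (hη : (∑ x, p x * ∑ y, if T * outputLaw p A y < A x y then 0 else A x y) + M * K / T +
      (∑ x, p x * ∑ z, B x z * Real.log (1 + B x z / (K * outputLaw p B z))) ≤ η) :
    ∃ (c : Fin M → Fin K → X) (dec : Y → Fin M), (∀ w k, p (c w k) ≠ 0) ∧
      (∑ w, (∑ k, ∑ y, if dec y ≠ w then A (c w k) y else 0) / K) / M ≤ η ∧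
      (∑ w, ∑ z, (∑ k, B (c w k) z) / K *
        Real.log ((∑ k, B (c w k) z) / K / outputLaw p B z)) / M ≤ η := by
  have hM' : (0 : ℝ) < M := by exact_mod_cast hM
  have hK' : (0 : ℝ) < K := by exact_mod_cast hK
  -- Any codeword passing the test may be chosen, since `hD` only concerns the case of a single one.
  -- The fallback when none passes is arbitrary.
  let D : (Fin M × Fin K → X) → Y → Fin M × Fin K := fun c y =>
    if h : ∃ i, T * outputLaw p A y < A (c i) y then h.choose else (⟨0, hM⟩, ⟨0, hK⟩)
  have hD : ∀ c y i, T * outputLaw p A y < A (c i) y →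
      (∀ j, j ≠ i → ¬ T * outputLaw p A y < A (c j) y) → D c y = i := by
    intro c y i h1 h2
    have h : ∃ i, T * outputLaw p A y < A (c i) y := ⟨i, h1⟩
    simp only [D, dif_pos h]
    by_contra hne
    exact h2 _ hne h.choose_spec
  let err : (Fin M × Fin K → X) → ℝ := fun c =>
    ∑ w, ∑ k, 1 / ((M : ℝ) * K) * ∑ y, if D c y ≠ (w, k) then A (c (w, k)) y else 0
  let leak : (Fin M × Fin K → X) → ℝ := fun c =>
    ∑ w, ∑ k, 1 / ((M : ℝ) * K) * ∑ z, B (c (w, k)) z *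
      Real.log ((∑ j, B (c (w, j)) z) / K / outputLaw p B z)
  have hmean : codebookMean p (fun c => err c + leak c) ≤ η := by
    rw [codebookMean_add]
    refine le_trans (add_le_add ?_ ?_) hη
    · refine codebookMean_average_le hM hK fun w k =>
        (codebookMean_threshold_le hp0 hp hA0 hA hT D hD (w, k)).trans (le_of_eq ?_)
      simp
    · exact codebookMean_average_le hM hK fun w k =>
        codebookMean_divergence_le hp0 hp hB0 k (fun j => (w, j)) (Prod.mk_right_injective w)
  obtain ⟨c, hc, hle⟩ := exists_le_of_codebookMean_le hp0 hp hmean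
  have hsupp : ∀ w z, outputLaw p B z = 0 → (∑ k, B (c (w, k)) z) / K = 0 := by
    intro w z h
    rw [Finset.sum_eq_zero fun k _ => eq_zero_of_outputLaw_eq_zero hp0 hB0 (hc (w, k)) h, zero_div]
  have hleak : leak c = (∑ w, ∑ z, (∑ k, B (c (w, k)) z) / K *
      Real.log ((∑ k, B (c (w, k)) z) / K / outputLaw p B z)) / M := by
    simp only [leak, Finset.sum_div]
    refine Finset.sum_congr rfl fun w _ => ?_
    simp_rw [Finset.mul_sum]
    rw [Finset.sum_comm]
    refine Finset.sum_congr rfl fun z _ => ?_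
    rw [Finset.sum_mul, Finset.sum_div]
    refine Finset.sum_congr rfl fun k _ => ?_
    field_simp
  -- With leakage and error both nonnegative, the bound on their sum bounds each of them.
  have hleak0 : 0 ≤ leak c := by
    rw [hleak]
    refine div_nonneg (Finset.sum_nonneg fun w _ => sum_mul_log_div_nonneg _ (fun z _ =>
      div_nonneg (Finset.sum_nonneg fun _ _ => hB0 _ _) hK'.le)
      (fun z _ => outputLaw_nonneg hp0 hB0 z) (fun z _ => hsupp w z) ?_) hM'.le
    rw [sum_outputLaw hp hB, ← Finset.sum_div, Finset.sum_comm]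
    simp [hB, hK'.ne']
  have herr0 : 0 ≤ err c := Finset.sum_nonneg fun w _ => Finset.sum_nonneg fun k _ =>
    mul_nonneg (by positivity) (Finset.sum_nonneg fun y _ => by split_ifs <;> simp [hA0])
  refine ⟨fun w k => c (w, k), fun y => (D c y).1, fun w k => hc (w, k), ?_, ?_⟩
  · refine le_trans ?_ ((le_add_of_nonneg_right hleak0).trans hle)
    simp only [err, Finset.sum_div]
    refine Finset.sum_le_sum fun w _ => Finset.sum_le_sum fun k _ => ?_
    rw [Finset.mul_sum]
    refine Finset.sum_le_sum fun y _ => ?_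
    -- The decoder discards the randomisation index, so an error in the message is also an error in
    -- the pair.
    by_cases h : (D c y).1 ≠ w
    · have h' : D c y ≠ (w, k) := fun h' => h (by rw [h'])
      rw [if_pos h, if_pos h', div_div, mul_comm (K : ℝ)]
      exact le_of_eq (by ring)
    · rw [if_neg h, zero_div, zero_div]
      exact mul_nonneg (by positivity) (by split_ifs <;> simp [hA0])
  · rw [← hleak]
    linarith

end OneShot

/-! ### Wiretap codes for memoryless channels -/

section Block

variable {X Y Z : Type*} [Fintype X] [Fintype Y] [Fintype Z] {p : X → ℝ}

/-- The mutual information, in nats, between the input and the output of the channel `A` with input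
distribution `p`. -/
noncomputable def channelInfo (p : X → ℝ) (A : X → Y → ℝ) : ℝ :=
  ∑ x, p x * ∑ y, A x y * Real.log (A x y / outputLaw p A y)

theorem channelInfo_nonneg {A : X → Y → ℝ} (hp0 : ∀ x, 0 ≤ p x) (hp : ∑ x, p x = 1)
    (hA0 : ∀ x y, 0 ≤ A x y) (hA : ∀ x, ∑ y, A x y = 1) : 0 ≤ channelInfo p A := by
  refine Finset.sum_nonneg fun x _ => ?_
  by_cases hx : p x = 0
  · simp [hx]
  · refine mul_nonneg (hp0 x) (sum_mul_log_div_nonneg _ (fun y _ => hA0 x y)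
      (fun y _ => outputLaw_nonneg hp0 hA0 y)
      (fun y _ => eq_zero_of_outputLaw_eq_zero hp0 hA0 hx) ?_)
    rw [sum_outputLaw hp hA, hA]

theorem sum_sum_prod {n : ℕ} (F : X → Y → ℝ) :
    ∑ x : Fin n → X, ∑ y : Fin n → Y, ∏ i, F (x i) (y i) = (∑ x, ∑ y, F x y) ^ n := by
  have h1 : ∀ x : Fin n → X, ∑ y : Fin n → Y, ∏ i, F (x i) (y i) = ∏ i, ∑ y, F (x i) y := by
    intro x
    rw [Finset.prod_univ_sum, Fintype.piFinset_univ]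
  simp_rw [h1]
  rw [← Fintype.piFinset_univ, ← Finset.prod_univ_sum (fun _ => Finset.univ)
    (fun _ x => ∑ y, F x y)]
  simp

omit [Fintype X] in
theorem sum_block_prod {n : ℕ} {A : X → Y → ℝ} (hA : ∀ x, ∑ y, A x y = 1) (x : Fin n → X) :
    ∑ y : Fin n → Y, ∏ i, A (x i) (y i) = 1 := by
  rw [← Fintype.piFinset_univ, ← Finset.prod_univ_sum]
  simp [hA]

omit [Fintype Y] in
theorem outputLaw_block {n : ℕ} (p : X → ℝ) (A : X → Y → ℝ) (y : Fin n → Y) :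
    outputLaw (fun x : Fin n → X => ∏ i, p (x i)) (fun x y => ∏ i, A (x i) (y i)) y =
      ∏ i, outputLaw p A (y i) := by
  simp only [outputLaw, ← Finset.prod_mul_distrib]
  rw [Finset.prod_univ_sum, Fintype.piFinset_univ]

omit [Fintype Y] in
/-- On the support, the likelihood ratio of a block is the exponential of the summed
information density. -/
theorem prod_div_outputLaw {n : ℕ} {A : X → Y → ℝ} (hp0 : ∀ x, 0 ≤ p x) (hA0 : ∀ x y, 0 ≤ A x y)
    {x : Fin n → X} {y : Fin n → Y} (hx : ∀ i, p (x i) ≠ 0) (hy : ∀ i, A (x i) (y i) ≠ 0) :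
    0 < ∏ i, outputLaw p A (y i) ∧ (∏ i, A (x i) (y i)) / ∏ i, outputLaw p A (y i) =
      Real.exp (∑ i, Real.log (A (x i) (y i) / outputLaw p A (y i))) := by
  have hq : ∀ i, 0 < outputLaw p A (y i) := fun i =>
    lt_of_le_of_ne (outputLaw_nonneg hp0 hA0 _) fun h =>
      hy i (eq_zero_of_outputLaw_eq_zero hp0 hA0 (hx i) h.symm)
  refine ⟨Finset.prod_pos fun i _ => hq i, ?_⟩
  rw [← Finset.prod_div_distrib, Real.exp_sum]
  refine Finset.prod_congr rfl fun i _ => (Real.exp_log (div_pos ?_ (hq i))).symm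
  exact lt_of_le_of_ne (hA0 _ _) (hy i).symm

open Classical in
-- Chernoff bound: where the test fails, the summed density is at most `n * γ`, so the exponential
-- factor is at least 1. The resulting sum factorises into an `n`-th power.
theorem sum_threshold_le {A : X → Y → ℝ} (hp0 : ∀ x, 0 ≤ p x) (hA0 : ∀ x y, 0 ≤ A x y)
    (n : ℕ) {s γ : ℝ} (hs : 0 < s) :
    (∑ x : Fin n → X, (∏ i, p (x i)) * ∑ y : Fin n → Y,
      if Real.exp (n * γ) * ∏ i, outputLaw p A (y i) < ∏ i, A (x i) (y i) then 0
      else ∏ i, A (x i) (y i)) ≤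
    (∑ x, ∑ y, p x * A x y *
      Real.exp (s * (γ - Real.log (A x y / outputLaw p A y)))) ^ n := by
  rw [← sum_sum_prod]
  simp_rw [Finset.mul_sum]
  refine Finset.sum_le_sum fun x _ => Finset.sum_le_sum fun y _ => ?_
  have hR : 0 ≤ ∏ i, p (x i) * A (x i) (y i) *
      Real.exp (s * (γ - Real.log (A (x i) (y i) / outputLaw p A (y i)))) :=
    Finset.prod_nonneg fun i _ => mul_nonneg (mul_nonneg (hp0 _) (hA0 _ _)) (Real.exp_pos _).le
  split_ifs with h
  · simpa using hR
  by_cases h0 : ∏ i, p (x i) * A (x i) (y i) = 0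
  · rw [← Finset.prod_mul_distrib, h0]; exact hR
  have h0' := Finset.prod_ne_zero_iff.1 h0
  obtain ⟨hq, hL⟩ := prod_div_outputLaw hp0 hA0
    (fun i => left_ne_zero_of_mul (h0' i (Finset.mem_univ i)))
    (fun i => right_ne_zero_of_mul (h0' i (Finset.mem_univ i)))
  rw [not_lt, ← div_le_iff₀ hq, hL, Real.exp_le_exp] at h
  rw [Finset.prod_mul_distrib, ← Finset.prod_mul_distrib, ← Real.exp_sum]
  refine le_mul_of_one_le_right (Finset.prod_nonneg fun i _ => mul_nonneg (hp0 _) (hA0 _ _)) ?_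
  rw [← Finset.mul_sum, Finset.sum_sub_distrib]
  simp only [Finset.sum_const, Finset.card_univ, Fintype.card_fin, nsmul_eq_mul]
  exact Real.one_le_exp (mul_nonneg hs.le (sub_nonneg.2 h))

/-- The covering counterpart of the Chernoff bound: `log_one_add_le_rpow_div` turns the logarithm
into an exponential of the summed density minus `n * κ`, up to the factor `1 / s`. -/
theorem sum_log_one_add_le {B : X → Z → ℝ} (hp0 : ∀ x, 0 ≤ p x) (hB0 : ∀ x z, 0 ≤ B x z)
    (n : ℕ) {s κ K : ℝ} (hs : 0 < s) (hs1 : s ≤ 1) (hK : Real.exp (n * κ) ≤ K) :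
    (∑ x : Fin n → X, (∏ i, p (x i)) * ∑ z : Fin n → Z, (∏ i, B (x i) (z i)) *
      Real.log (1 + (∏ i, B (x i) (z i)) / (K * ∏ i, outputLaw p B (z i)))) ≤
    (∑ x, ∑ z, p x * B x z *
      Real.exp (s * (Real.log (B x z / outputLaw p B z) - κ))) ^ n / s := by
  rw [← sum_sum_prod]
  simp_rw [Finset.mul_sum, Finset.sum_div]
  refine Finset.sum_le_sum fun x _ => Finset.sum_le_sum fun z _ => ?_
  have hR : 0 ≤ (∏ i, p (x i) * B (x i) (z i) *
      Real.exp (s * (Real.log (B (x i) (z i) / outputLaw p B (z i)) - κ))) / s :=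
    div_nonneg (Finset.prod_nonneg fun i _ =>
      mul_nonneg (mul_nonneg (hp0 _) (hB0 _ _)) (Real.exp_pos _).le) hs.le
  rw [← mul_assoc]
  by_cases h0 : ∏ i, p (x i) * B (x i) (z i) = 0
  · rw [← Finset.prod_mul_distrib, h0, zero_mul]; exact hR
  have h0' := Finset.prod_ne_zero_iff.1 h0
  obtain ⟨hq, hL⟩ := prod_div_outputLaw hp0 hB0
    (fun i => left_ne_zero_of_mul (h0' i (Finset.mem_univ i)))
    (fun i => right_ne_zero_of_mul (h0' i (Finset.mem_univ i)))
  have hK0 : 0 < K := (Real.exp_pos _).trans_le hK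
  rw [Finset.prod_mul_distrib, ← Finset.prod_mul_distrib, ← Real.exp_sum, mul_div_assoc]
  refine mul_le_mul_of_nonneg_left ?_ (Finset.prod_nonneg fun i _ => mul_nonneg (hp0 _) (hB0 _ _))
  have ht : (∏ i, B (x i) (z i)) / (K * ∏ i, outputLaw p B (z i)) ≤
      Real.exp (∑ i, (Real.log (B (x i) (z i) / outputLaw p B (z i)) - κ)) := by
    rw [mul_comm K, ← div_div, hL, Finset.sum_sub_distrib, Real.exp_sub]
    refine div_le_div_of_nonneg_left (Real.exp_pos _).le (Real.exp_pos _) ?_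
    simpa using hK
  have ht0 : 0 ≤ (∏ i, B (x i) (z i)) / (K * ∏ i, outputLaw p B (z i)) :=
    div_nonneg (Finset.prod_nonneg fun i _ => hB0 _ _) (mul_nonneg hK0.le hq.le)
  refine (log_one_add_le_rpow_div ht0 hs hs1).trans ?_
  rw [← Finset.mul_sum, mul_comm s, Real.exp_mul]
  exact div_le_div_of_nonneg_right (Real.rpow_le_rpow ht0 ht hs.le) hs.le

/-- The exponential moment bound for the information density. -/
theorem exists_informationDensity_moment_lt_one {A : X → Y → ℝ} (hp : ∑ x, p x = 1)
    (hA : ∀ x, ∑ y, A x y = 1) {u b : ℝ} (h : u * channelInfo p A + b < 0) :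
    ∃ s : ℝ, 0 < s ∧ s ≤ 1 ∧ ∑ x, ∑ y, p x * A x y *
      Real.exp (s * (u * Real.log (A x y / outputLaw p A y) + b)) < 1 := by
  have h1 : ∑ i : X × Y, p i.1 * A i.1 i.2 = 1 := by
    rw [Fintype.sum_prod_type]
    simp [← Finset.mul_sum, hA, hp]
  have h2 : ∑ i : X × Y, p i.1 * A i.1 i.2 *
      (u * Real.log (A i.1 i.2 / outputLaw p A i.2) + b) < 0 := by
    refine lt_of_eq_of_lt ?_ h
    simp_rw [mul_add]
    rw [Finset.sum_add_distrib, ← Finset.sum_mul, h1, one_mul, Fintype.sum_prod_type]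
    congr 1
    rw [channelInfo, Finset.mul_sum]
    refine Finset.sum_congr rfl fun x _ => ?_
    rw [← mul_assoc, Finset.mul_sum]
    exact Finset.sum_congr rfl fun y _ => by ring
  obtain ⟨s, hs, hs1, hlt⟩ := exists_sum_mul_exp_lt_one Finset.univ _ _ h1 h2
  rw [Fintype.sum_prod_type] at hlt
  exact ⟨s, hs, hs1, hlt⟩

theorem ceil_exp_bounds {a : ℝ} (ha : 0 ≤ a) :
    0 < ⌈Real.exp a⌉₊ ∧ Real.exp a ≤ ⌈Real.exp a⌉₊ ∧ (⌈Real.exp a⌉₊ : ℝ) ≤ 2 * Real.exp a := by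
  refine ⟨Nat.ceil_pos.2 (Real.exp_pos a), Nat.le_ceil _, ?_⟩
  have := Nat.ceil_lt_add_one (Real.exp_pos a).le
  have := Real.one_le_exp ha
  linarith

/-- The wiretap coding theorem at positive rates: a legitimate receiver with a larger mutual
information than the eavesdropper admits codes with small error and small leakage. -/
theorem exists_block_code {A : X → Y → ℝ} {B : X → Z → ℝ} (hp0 : ∀ x, 0 ≤ p x)
    (hp : ∑ x, p x = 1) (hA0 : ∀ x y, 0 ≤ A x y) (hA : ∀ x, ∑ y, A x y = 1)
    (hB0 : ∀ x z, 0 ≤ B x z) (hB : ∀ x, ∑ z, B x z = 1)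
    (h : channelInfo p B < channelInfo p A) :
    ∃ R : ℝ, 0 < R ∧ ∀ ε : ℝ, 0 < ε → ∃ N : ℕ, ∀ n ≥ N, ∃ (M K : ℕ)
      (c : Fin M → Fin K → Fin n → X) (dec : (Fin n → Y) → Fin M),
      0 < M ∧ 0 < K ∧ Real.exp (n * R) ≤ M ∧ (∀ w k i, p (c w k i) ≠ 0) ∧
      (∑ w, (∑ k, ∑ y, if dec y ≠ w then ∏ i, A (c w k i) (y i) else 0) / K) / M ≤ ε ∧
      (∑ w, ∑ z : Fin n → Z, (∑ k, ∏ i, B (c w k i) (z i)) / K *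
        Real.log ((∑ k, ∏ i, B (c w k i) (z i)) / K / ∏ i, outputLaw p B (z i))) / M ≤ ε := by
  classical
  set I := channelInfo p A with hI
  set J := channelInfo p B with hJ
  -- Makes the exponent `n * (J + δ)` nonnegative, as `ceil_exp_bounds` requires.
  have hJ0 : 0 ≤ J := channelInfo_nonneg hp0 hp hB0 hB
  -- Message rate `δ`, randomisation rate `J + δ` and threshold exponent `J + 3 * δ`: the total rate
  -- is `δ` below the threshold, and the threshold is below `I`.
  obtain ⟨δ, hδ, hδI⟩ : ∃ δ : ℝ, 0 < δ ∧ J + 3 * δ < I :=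
    ⟨(I - J) / 4, by linarith, by linarith⟩
  obtain ⟨s, hs, -, hg⟩ := exists_informationDensity_moment_lt_one hp hA
    (u := -1) (b := J + 3 * δ) (by rw [← hI]; linarith)
  obtain ⟨t, ht, ht1, hk⟩ := exists_informationDensity_moment_lt_one hp hB
    (u := 1) (b := -(J + δ)) (by rw [← hJ]; linarith)
  set g := ∑ x, ∑ y, p x * A x y *
    Real.exp (s * (-1 * Real.log (A x y / outputLaw p A y) + (J + 3 * δ))) with hgdef
  set k := ∑ x, ∑ z, p x * B x z *
    Real.exp (t * (1 * Real.log (B x z / outputLaw p B z) + -(J + δ))) with hkdef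
  have hg0 : 0 ≤ g := Finset.sum_nonneg fun x _ => Finset.sum_nonneg fun y _ =>
    mul_nonneg (mul_nonneg (hp0 x) (hA0 x y)) (Real.exp_pos _).le
  have hk0 : 0 ≤ k := Finset.sum_nonneg fun x _ => Finset.sum_nonneg fun z _ =>
    mul_nonneg (mul_nonneg (hp0 x) (hB0 x z)) (Real.exp_pos _).le
  -- The terms bound the failed test, the competing codewords and the leakage. The 4 is the product
  -- of the two factors 2 lost by rounding `M` and `K` up.
  have hlim : Filter.Tendsto (fun n : ℕ => g ^ n + 4 * Real.exp (-δ) ^ n + k ^ n / t)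
      Filter.atTop (nhds 0) := by
    have h1 := tendsto_pow_atTop_nhds_zero_of_lt_one hg0 hg
    have h2 := tendsto_pow_atTop_nhds_zero_of_lt_one (Real.exp_pos (-δ)).le
      (Real.exp_lt_one_iff.2 (by linarith))
    have h3 := tendsto_pow_atTop_nhds_zero_of_lt_one hk0 hk
    simpa using (h1.add (h2.const_mul 4)).add (h3.div_const t)
  refine ⟨δ, hδ, fun ε hε => ?_⟩
  obtain ⟨N, hN⟩ := Filter.eventually_atTop.1 (hlim.eventually_le_const hε)
  refine ⟨N, fun n hn => ?_⟩
  obtain ⟨hM, hMl, hMu⟩ := ceil_exp_bounds (show 0 ≤ n * δ by positivity)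
  obtain ⟨hK, hKl, hKu⟩ := ceil_exp_bounds (show 0 ≤ n * (J + δ) by positivity)
  set M := ⌈Real.exp (n * δ)⌉₊
  set K := ⌈Real.exp (n * (J + δ))⌉₊
  have hη : (∑ x : Fin n → X, (∏ i, p (x i)) * ∑ y : Fin n → Y,
        if Real.exp (n * (J + 3 * δ)) * outputLaw (fun x : Fin n → X => ∏ i, p (x i))
          (fun x y => ∏ i, A (x i) (y i)) y < ∏ i, A (x i) (y i) then 0
        else ∏ i, A (x i) (y i)) + M * K / Real.exp (n * (J + 3 * δ)) +
      (∑ x : Fin n → X, (∏ i, p (x i)) * ∑ z : Fin n → Z, (∏ i, B (x i) (z i)) *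
        Real.log (1 + (∏ i, B (x i) (z i)) / (K * outputLaw (fun x : Fin n → X => ∏ i, p (x i))
          (fun x z => ∏ i, B (x i) (z i)) z))) ≤ ε := by
    simp only [outputLaw_block]
    refine le_trans (add_le_add (add_le_add ?_ ?_) ?_) (hN n hn)
    · refine (sum_threshold_le hp0 hA0 n hs).trans (le_of_eq ?_)
      rw [hgdef]
      simp only [neg_one_mul, neg_add_eq_sub]
    · rw [div_le_iff₀ (Real.exp_pos _), ← Real.exp_nat_mul, mul_assoc, ← Real.exp_add]
      calc (M : ℝ) * K ≤ (2 * Real.exp (n * δ)) * (2 * Real.exp (n * (J + δ))) :=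
            mul_le_mul hMu hKu (by positivity) (by positivity)
        _ = 4 * Real.exp (n * δ + n * (J + δ)) := by rw [Real.exp_add]; ring
        _ = _ := by ring_nf
    · refine (sum_log_one_add_le hp0 hB0 n ht ht1 hKl).trans (le_of_eq ?_)
      rw [hkdef]
      simp only [one_mul, sub_eq_add_neg]
  obtain ⟨c, dec, h1, h2, h3⟩ := exists_oneShot_code
    (p := fun x : Fin n → X => ∏ i, p (x i)) (A := fun x (y : Fin n → Y) => ∏ i, A (x i) (y i))
    (B := fun x (z : Fin n → Z) => ∏ i, B (x i) (z i))
    (fun x => Finset.prod_nonneg fun i _ => hp0 (x i)) (sum_prod_eq_one hp)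
    (fun x y => Finset.prod_nonneg fun i _ => hA0 (x i) (y i)) (sum_block_prod hA)
    (fun x z => Finset.prod_nonneg fun i _ => hB0 (x i) (z i)) (sum_block_prod hB)
    (Real.exp_pos _) hM hK hη
  refine ⟨M, K, c, dec, hM, hK, hMl, fun w k i =>
    (Finset.prod_ne_zero_iff.1 (h1 w k)) i (Finset.mem_univ i), ?_, ?_⟩
  · convert h2
  · simpa only [outputLaw_block] using h3

end Block

/-! ### Conditional entropy -/

section Entropy

variable {Ω A B C : Type*} [Fintype Ω]

theorem law_nonneg {p : Ω → ℝ} (hp : ∀ ω, 0 ≤ p ω) (X : Ω → A) (a : A) : 0 ≤ law p X a :=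
  Finset.sum_nonneg fun ω _ => by split_ifs <;> simp [hp]

theorem sum_law_fst [Fintype A] (p : Ω → ℝ) (X : Ω → A) (Y : Ω → B) (b : B) :
    ∑ a, law p (fun ω => (X ω, Y ω)) (a, b) = law p Y b := by
  classical
  unfold law
  rw [Finset.sum_comm]
  refine Finset.sum_congr rfl fun ω _ => ?_
  by_cases h : Y ω = b <;> simp [h]

theorem sum_law_middle [Fintype C] (p : Ω → ℝ) (X : Ω → A) (Y : Ω → B) (Z : Ω → C) (a : A)
    (b : B) : ∑ c, law p (fun ω => (X ω, (Z ω, Y ω))) (a, (c, b)) =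
      law p (fun ω => (X ω, Y ω)) (a, b) := by
  classical
  unfold law
  rw [Finset.sum_comm]
  refine Finset.sum_congr rfl fun ω _ => ?_
  by_cases h : X ω = a <;> by_cases h' : Y ω = b <;> simp [h, h']

variable [Fintype A] [Fintype B] [Fintype C]

theorem condEntropy_eq (p : Ω → ℝ) (X : Ω → A) (Y : Ω → B) :
    condEntropy p X Y = -(∑ b, ∑ a, law p (fun ω => (X ω, Y ω)) (a, b) *
      Real.log (law p (fun ω => (X ω, Y ω)) (a, b) / law p Y b)) / Real.log 2 := by
  rw [condEntropy, Finset.sum_comm, neg_div]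
  simp only [Real.logb, Finset.sum_div, mul_div_assoc]

/-- Replacing the marginal by another distribution `r` increases the sum. -/
theorem sum_mul_log_div_marginal_le {f : A → B → ℝ} (hf : ∀ a b, 0 ≤ f a b) {r : B → ℝ}
    (hr : ∀ b, 0 ≤ r b) (hrf : ∀ b, r b = 0 → ∀ a, f a b = 0)
    (hsum : ∑ b, r b ≤ ∑ b, ∑ a, f a b) :
    ∑ b, ∑ a, f a b * Real.log (f a b / ∑ a', f a' b) ≤
      ∑ b, ∑ a, f a b * Real.log (f a b / r b) := by
  -- The difference of the two sides is the divergence of the true marginal from `r`.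
  have h0 : 0 ≤ ∑ b, (∑ a, f a b) * Real.log ((∑ a, f a b) / r b) :=
    sum_mul_log_div_nonneg _ (fun b _ => Finset.sum_nonneg fun a _ => hf a b) (fun b _ => hr b)
      (fun b _ h => Finset.sum_eq_zero fun a _ => hrf b h a) hsum
  have h1 : ∀ b a, f a b * Real.log (f a b / r b) =
      f a b * Real.log (f a b / ∑ a', f a' b) + f a b * Real.log ((∑ a', f a' b) / r b) := by
    intro b a
    rcases (hf a b).eq_or_lt with h | h
    · simp [← h]
    have hS : 0 < ∑ a', f a' b :=
      h.trans_le (Finset.single_le_sum (f := fun a => f a b) (fun a _ => hf a b) (Finset.mem_univ a))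
    have hr' : 0 < r b := lt_of_le_of_ne (hr b) fun h' => h.ne' (hrf b h'.symm a)
    rw [← mul_add, ← Real.log_mul (by positivity) (by positivity)]
    congr 2
    field_simp
  simp only [h1, Finset.sum_add_distrib, ← Finset.sum_mul]
  linarith

/-- Conditioning on a further random variable decreases the entropy. -/
theorem condEntropy_pair_le {p : Ω → ℝ} (hp : ∀ ω, 0 ≤ p ω) (X : Ω → A) (Y : Ω → B)
    (Z : Ω → C) : condEntropy p X (fun ω => (Z ω, Y ω)) ≤ condEntropy p X Y := by
  rw [condEntropy_eq, condEntropy_eq]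
  have hlog : 0 < Real.log 2 := Real.log_pos one_lt_two
  refine div_le_div_of_nonneg_right (neg_le_neg ?_) hlog.le
  rw [Fintype.sum_prod_type_right]
  refine Finset.sum_le_sum fun b _ => ?_
  set f : A → C → ℝ := fun a c => law p (fun ω => (X ω, (Z ω, Y ω))) (a, (c, b)) with hf
  set g : C → ℝ := fun c => law p (fun ω => (Z ω, Y ω)) (c, b) with hg
  have hf0 : ∀ a c, 0 ≤ f a c := fun a c => law_nonneg hp _ _
  have hg0 : ∀ c, 0 ≤ g c := fun c => law_nonneg hp _ _
  have hfg : ∀ c, ∑ a, f a c = g c := fun c => sum_law_fst p X (fun ω => (Z ω, Y ω)) (c, b)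
  have hfa : ∀ a, law p (fun ω => (X ω, Y ω)) (a, b) = ∑ c, f a c := fun a =>
    (sum_law_middle p X Y Z a b).symm
  have hgb : law p Y b = ∑ c, g c := (sum_law_fst p Z Y b).symm
  simp only [hfa, hgb]
  change ∑ a, (∑ c, f a c) * Real.log ((∑ c, f a c) / ∑ c, g c) ≤
    ∑ c, ∑ a, f a c * Real.log (f a c / g c)
  have hle : ∀ a c, f a c ≤ g c := fun a c => by
    rw [← hfg]
    exact Finset.single_le_sum (f := fun a => f a c) (fun a _ => hf0 a c) (Finset.mem_univ a)
  -- For fixed `b` this is the unnormalised mutual information of `X` and `Z`: the divergence of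
  -- their joint law from the product of its marginals, rescaled to the same total mass.
  have h0 : 0 ≤ ∑ i : A × C, f i.1 i.2 *
      Real.log (f i.1 i.2 / (g i.2 * (∑ c, f i.1 c) / ∑ c, g c)) := by
    refine sum_mul_log_div_nonneg _ (fun i _ => hf0 _ _) (fun i _ => ?_) (fun i _ h => ?_) ?_
    · exact div_nonneg (mul_nonneg (hg0 _) (Finset.sum_nonneg fun _ _ => hf0 _ _))
        (Finset.sum_nonneg fun _ _ => hg0 _)
    · have h1 : f i.1 i.2 ≤ ∑ c, f i.1 c :=
        Finset.single_le_sum (f := fun c => f i.1 c) (fun c _ => hf0 _ c) (Finset.mem_univ i.2)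
      have h2 : g i.2 ≤ ∑ c, g c := Finset.single_le_sum (fun c _ => hg0 c) (Finset.mem_univ i.2)
      rcases div_eq_zero_iff.1 h with h | h
      · rcases mul_eq_zero.1 h with h | h
        · exact le_antisymm (h ▸ hle i.1 i.2) (hf0 _ _)
        · exact le_antisymm (h ▸ h1) (hf0 _ _)
      · exact le_antisymm ((hle i.1 i.2).trans (h ▸ h2)) (hf0 _ _)
    · have hS : ∑ a, ∑ c, f a c = ∑ c, g c := by rw [Finset.sum_comm]; simp only [hfg]
      rw [Fintype.sum_prod_type, Fintype.sum_prod_type, hS]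
      simp only
      simp_rw [← Finset.sum_div, ← Finset.sum_mul, ← Finset.mul_sum, hS]
      exact le_of_eq (by
        rcases eq_or_ne (∑ c, g c) 0 with h | h
        · rw [h]; simp
        · field_simp)
  have h1 : ∀ a c, f a c * Real.log (f a c / (g c * (∑ c, f a c) / ∑ c, g c)) =
      f a c * Real.log (f a c / g c) - f a c * Real.log ((∑ c, f a c) / ∑ c, g c) := by
    intro a c
    rcases (hf0 a c).eq_or_lt with h | h
    · simp [← h]
    have hg1 : 0 < g c := h.trans_le (hle a c)
    have hF : 0 < ∑ c, f a c :=
      h.trans_le (Finset.single_le_sum (fun c _ => hf0 a c) (Finset.mem_univ c))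
    have hG : 0 < ∑ c, g c :=
      hg1.trans_le (Finset.single_le_sum (fun c _ => hg0 c) (Finset.mem_univ c))
    rw [← mul_sub, ← Real.log_div (by positivity) (by positivity)]
    congr 2
    field_simp
  rw [Fintype.sum_prod_type] at h0
  simp only [h1, Finset.sum_sub_distrib, ← Finset.sum_mul] at h0
  rw [Finset.sum_comm (s := (Finset.univ : Finset C))]
  linarith

/-- The equivocation of a uniform message whose observation splits into an informative part with
conditional distribution `Q` and an independent part with distribution `G`. -/
theorem condEntropy_ge_of_law_eq {Z Z' : Type*} [Fintype Z] [Fintype Z'] {M : ℕ} (hM : 0 < M)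
    {p : Ω → ℝ} {X : Ω → Fin M} {Y : Ω → B} (e : B ≃ Z × Z') {Q : Fin M → Z → ℝ} {G : Z' → ℝ}
    (hlaw : ∀ w b, law p (fun ω => (X ω, Y ω)) (w, b) = 1 / M * Q w (e b).1 * G (e b).2)
    (hQ0 : ∀ w z, 0 ≤ Q w z) (hQ : ∀ w, ∑ z, Q w z = 1) (hG0 : ∀ z, 0 ≤ G z)
    (hG : ∑ z, G z = 1) {r : Z → ℝ} (hr0 : ∀ z, 0 ≤ r z) (hr : ∑ z, r z ≤ 1)
    (hrQ : ∀ w z, r z = 0 → Q w z = 0) :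
    (Real.log M - (∑ w, ∑ z, Q w z * Real.log (Q w z / r z)) / M) / Real.log 2 ≤
      condEntropy p X Y := by
  have hM' : (0 : ℝ) < M := by exact_mod_cast hM
  have hlog : 0 < Real.log 2 := Real.log_pos one_lt_two
  rw [condEntropy_eq]
  refine div_le_div_of_nonneg_right ?_ hlog.le
  simp only [← sum_law_fst p X Y, hlaw]
  rw [le_neg]
  refine (sum_mul_log_div_marginal_le (r := fun b => r (e b).1 * G (e b).2)
    (fun w b => mul_nonneg (mul_nonneg (by positivity) (hQ0 _ _)) (hG0 _))
    (fun b => mul_nonneg (hr0 _) (hG0 _)) (fun b h w => ?_) ?_).trans (le_of_eq ?_)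
  · rcases mul_eq_zero.1 h with h | h
    · rw [hrQ w _ h]; simp
    · rw [h]; simp
  · rw [e.sum_comp (fun z => r z.1 * G z.2), e.sum_comp (fun z => ∑ w, 1 / M * Q w z.1 * G z.2),
      Fintype.sum_prod_type, Fintype.sum_prod_type]
    simp only [← Finset.mul_sum, hG, mul_one, ← Finset.sum_mul]
    rw [Finset.sum_comm]
    simp only [hQ]
    simpa [hM'.ne'] using hr
  · rw [e.sum_comp (fun z => ∑ w, 1 / M * Q w z.1 * G z.2 *
      Real.log (1 / M * Q w z.1 * G z.2 / (r z.1 * G z.2))), Fintype.sum_prod_type]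
    -- The independent factor `G` cancels inside the logarithm, and the uniform prior contributes
    -- `-log M`.
    have h1 : ∀ z z' w, 1 / M * Q w z * G z' * Real.log (1 / M * Q w z * G z' / (r z * G z')) =
        (Q w z * Real.log (Q w z / r z) / M - Q w z * (Real.log M / M)) * G z' := by
      intro z z' w
      by_cases hz' : G z' = 0
      · simp [hz']
      rcases (hQ0 w z).eq_or_lt with h | h
      · simp [← h]
      have hrz : 0 < r z := lt_of_le_of_ne (hr0 z) fun h' => h.ne' (hrQ w z h'.symm)
      rw [mul_div_mul_right _ _ hz', mul_div_assoc, Real.log_mul (by positivity) (by positivity),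
        one_div, Real.log_inv]
      field_simp
      ring
    simp only [h1, ← Finset.sum_mul, ← Finset.mul_sum, hG, mul_one]
    rw [Finset.sum_comm]
    simp only [Finset.sum_sub_distrib, ← Finset.sum_mul, hQ, ← Finset.sum_div]
    simp only [Finset.sum_const, Finset.card_univ, Fintype.card_fin, nsmul_eq_mul]
    field_simp
    ring

end Entropy

/-! ### Codes for one confidential message -/

section Wiretap

variable {𝒱 𝒳 𝒴 𝒵 : Type*} [Fintype 𝒱] [Fintype 𝒳] [Fintype 𝒴] [Fintype 𝒵]

/-- The output distribution of the memoryless channel `W` for a random input block. -/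
def blockOutput {n : ℕ} (W : 𝒳 → stdSimplex ℝ (𝒴 × 𝒵)) (f : stdSimplex ℝ (Fin n → 𝒳))
    (y : Fin n → 𝒴) (z : Fin n → 𝒵) : ℝ :=
  ∑ x, f x * blockChannel W x y z

theorem blockOutput_nonneg {n : ℕ} (W : 𝒳 → stdSimplex ℝ (𝒴 × 𝒵))
    (f : stdSimplex ℝ (Fin n → 𝒳)) (y : Fin n → 𝒴) (z : Fin n → 𝒵) : 0 ≤ blockOutput W f y z :=
  Finset.sum_nonneg fun x _ => mul_nonneg (f.2.1 x) (Finset.prod_nonneg fun i _ => (W (x i)).2.1 _)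

theorem sum_blockOutput {n : ℕ} (W : 𝒳 → stdSimplex ℝ (𝒴 × 𝒵))
    (f : stdSimplex ℝ (Fin n → 𝒳)) : ∑ y, ∑ z, blockOutput W f y z = 1 := by
  have h1 : ∀ x : Fin n → 𝒳, ∑ y : Fin n → 𝒴, ∑ z : Fin n → 𝒵, blockChannel W x y z = 1 := by
    intro x
    have h2 : ∀ y : Fin n → 𝒴, ∑ z : Fin n → 𝒵, blockChannel W x y z =
        ∏ i, ∑ z, W (x i) (y i, z) := by
      intro y
      rw [Finset.prod_univ_sum, Fintype.piFinset_univ]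
      rfl
    simp_rw [h2]
    rw [← Fintype.piFinset_univ, ← Finset.prod_univ_sum (fun _ => Finset.univ)
      (fun i y => ∑ z, W (x i) (y, z))]
    refine Finset.prod_eq_one fun i _ => ?_
    rw [← Fintype.sum_prod_type' (fun y z => W (x i) (y, z))]
    exact (W (x i)).2.2
  calc ∑ y, ∑ z, blockOutput W f y z
      = ∑ x, f x * ∑ y, ∑ z, blockChannel W x y z := by
        simp only [blockOutput, Finset.mul_sum]
        exact (Finset.sum_comm.trans (Finset.sum_congr rfl fun y _ => Finset.sum_comm)).symm
    _ = 1 := by simp only [h1, mul_one]; exact f.2.2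

/-- Random coding over `c` followed by the channel `q`, as a stochastic encoder. -/
noncomputable def mixtureEncoder {n K : ℕ} (hK : 0 < K) (q : 𝒱 → stdSimplex ℝ 𝒳) (c : Fin K → Fin n → 𝒱) :
    stdSimplex ℝ (Fin n → 𝒳) :=
  ⟨fun x => (∑ k, ∏ i, q (c k i) (x i)) / K, fun x =>
    div_nonneg (Finset.sum_nonneg fun k _ => Finset.prod_nonneg fun i _ => (q (c k i)).2.1 _)
      (Nat.cast_nonneg K), by
    have hK' : (K : ℝ) ≠ 0 := by exact_mod_cast hK.ne'
    have h1 : ∀ k, ∑ x : Fin n → 𝒳, ∏ i, q (c k i) (x i) = 1 := fun k => by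
      rw [← Fintype.piFinset_univ, ← Finset.prod_univ_sum (fun _ => Finset.univ)
        (fun i x => q (c k i) x)]
      exact Finset.prod_eq_one fun i _ => (q (c k i)).2.2
    rw [← Finset.sum_div, Finset.sum_comm]
    simp [h1, hK']⟩

omit [Fintype 𝒱] in
-- The memoryless prefix `q` and the channel merge letter by letter into one memoryless channel on
-- `𝒱`, to which `exists_block_code` applies.
theorem blockOutput_mixtureEncoder {n K : ℕ} (hK : 0 < K) (W : 𝒳 → stdSimplex ℝ (𝒴 × 𝒵))
    (q : 𝒱 → stdSimplex ℝ 𝒳) (c : Fin K → Fin n → 𝒱) (y : Fin n → 𝒴) (z : Fin n → 𝒵) :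
    blockOutput W (mixtureEncoder hK q c) y z =
      (∑ k, ∏ i, ∑ x, q (c k i) x * W x (y i, z i)) / K := by
  have h1 : ∀ k, ∏ i, ∑ x, q (c k i) x * W x (y i, z i) =
      ∑ x : Fin n → 𝒳, (∏ i, q (c k i) (x i)) * blockChannel W x y z := by
    intro k
    rw [Finset.prod_univ_sum, Fintype.piFinset_univ]
    simp only [Finset.prod_mul_distrib, blockChannel]
  simp only [h1]
  rw [Finset.sum_comm, Finset.sum_div]
  refine Finset.sum_congr rfl fun x _ => ?_
  rw [← Finset.sum_mul, mul_div_right_comm]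
  rfl

omit [Fintype 𝒱] in
theorem sum_blockOutput_mixtureEncoder_right {n K : ℕ} (hK : 0 < K)
    (W : 𝒳 → stdSimplex ℝ (𝒴 × 𝒵)) (q : 𝒱 → stdSimplex ℝ 𝒳) (c : Fin K → Fin n → 𝒱)
    (y : Fin n → 𝒴) : ∑ z, blockOutput W (mixtureEncoder hK q c) y z =
      (∑ k, ∏ i, ∑ z, ∑ x, q (c k i) x * W x (y i, z)) / K := by
  simp only [blockOutput_mixtureEncoder]
  rw [← Finset.sum_div, Finset.sum_comm]
  congr 1
  refine Finset.sum_congr rfl fun k _ => ?_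
  rw [Finset.prod_univ_sum, Fintype.piFinset_univ]

omit [Fintype 𝒱] in
theorem sum_blockOutput_mixtureEncoder_left {n K : ℕ} (hK : 0 < K)
    (W : 𝒳 → stdSimplex ℝ (𝒴 × 𝒵)) (q : 𝒱 → stdSimplex ℝ 𝒳) (c : Fin K → Fin n → 𝒱)
    (z : Fin n → 𝒵) : ∑ y, blockOutput W (mixtureEncoder hK q c) y z =
      (∑ k, ∏ i, ∑ y, ∑ x, q (c k i) x * W x (y, z i)) / K := by
  simp only [blockOutput_mixtureEncoder]
  rw [← Finset.sum_div, Finset.sum_comm]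
  congr 1
  refine Finset.sum_congr rfl fun k _ => ?_
  rw [Finset.prod_univ_sum, Fintype.piFinset_univ]

/-- The wiretap coding theorem with a channel prefix `q`. -/
theorem exists_wiretap_code (W : 𝒳 → stdSimplex ℝ (𝒴 × 𝒵)) {p : 𝒱 → ℝ} (hp0 : ∀ v, 0 ≤ p v)
    (hp : ∑ v, p v = 1) (q : 𝒱 → stdSimplex ℝ 𝒳)
    (h : channelInfo p (fun v z => ∑ y, ∑ x, q v x * W x (y, z)) <
      channelInfo p (fun v y => ∑ z, ∑ x, q v x * W x (y, z))) :
    ∃ R : ℝ, 0 < R ∧ ∀ ε : ℝ, 0 < ε → ∃ N : ℕ, ∀ n ≥ N, ∃ (M : ℕ)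
      (E : Fin M → stdSimplex ℝ (Fin n → 𝒳)) (dec : (Fin n → 𝒴) → Fin M) (r : (Fin n → 𝒵) → ℝ),
      0 < M ∧ Real.exp (n * R) ≤ M ∧
      (∑ w, ∑ y, if dec y ≠ w then ∑ z, blockOutput W (E w) y z else 0) / M ≤ ε ∧
      (∀ z, 0 ≤ r z) ∧ ∑ z, r z ≤ 1 ∧ (∀ w z, r z = 0 → ∑ y, blockOutput W (E w) y z = 0) ∧
      (∑ w, ∑ z, (∑ y, blockOutput W (E w) y z) *
        Real.log ((∑ y, blockOutput W (E w) y z) / r z)) / M ≤ ε := by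
  set A : 𝒱 → 𝒴 → ℝ := fun v y => ∑ z, ∑ x, q v x * W x (y, z) with hAdef
  set B : 𝒱 → 𝒵 → ℝ := fun v z => ∑ y, ∑ x, q v x * W x (y, z) with hBdef
  have hA0 : ∀ v y, 0 ≤ A v y := fun v y => Finset.sum_nonneg fun z _ =>
    Finset.sum_nonneg fun x _ => mul_nonneg ((q v).2.1 x) ((W x).2.1 _)
  have hB0 : ∀ v z, 0 ≤ B v z := fun v z => Finset.sum_nonneg fun y _ =>
    Finset.sum_nonneg fun x _ => mul_nonneg ((q v).2.1 x) ((W x).2.1 _)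
  have hA : ∀ v, ∑ y, A v y = 1 := by
    intro v
    rw [hAdef, ← Fintype.sum_prod_type' (fun y z => ∑ x, q v x * W x (y, z)), Finset.sum_comm]
    simp_rw [← Finset.mul_sum]
    calc ∑ x, q v x * ∑ i, W x i = ∑ x, q v x := Finset.sum_congr rfl fun x _ => by
          rw [show ∑ i, W x i = 1 from (W x).2.2, mul_one]
      _ = 1 := (q v).2.2
  have hB : ∀ v, ∑ z, B v z = 1 := by
    intro v
    rw [← hA v, hAdef, hBdef, Finset.sum_comm]
  obtain ⟨R, hR, hcode⟩ := exists_block_code hp0 hp hA0 hA hB0 hB h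
  refine ⟨R, hR, fun ε hε => ?_⟩
  obtain ⟨N, hN⟩ := hcode ε hε
  refine ⟨N, fun n hn => ?_⟩
  obtain ⟨M, K, c, dec, hM, hK, hMR, hc, herr, hleak⟩ := hN n hn
  have hQ : ∀ w (z : Fin n → 𝒵), ∑ y, blockOutput W (mixtureEncoder hK q (c w)) y z =
      (∑ k, ∏ i, B (c w k i) (z i)) / K := fun w z =>
    sum_blockOutput_mixtureEncoder_left hK W q (c w) z
  -- The reference law `r` is the i.i.d. output law. Its zeros are zeros of the code's output
  -- because codewords use only letters of positive probability.
  refine ⟨M, fun w => mixtureEncoder hK q (c w), dec, fun z => ∏ i, outputLaw p B (z i), hM, hMR,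
    ?_, fun z => Finset.prod_nonneg fun i _ => outputLaw_nonneg hp0 hB0 _, ?_, ?_, ?_⟩
  · refine le_trans (le_of_eq ?_) herr
    congr 1
    refine Finset.sum_congr rfl fun w _ => ?_
    rw [Finset.sum_comm, Finset.sum_div]
    refine Finset.sum_congr rfl fun y _ => ?_
    split_ifs
    · exact sum_blockOutput_mixtureEncoder_right hK W q (c w) y
    · simp
  · exact (sum_prod_eq_one (sum_outputLaw hp hB)).le
  · intro w z hz
    rw [Finset.prod_eq_zero_iff] at hz
    obtain ⟨i, -, hi⟩ := hz
    rw [hQ, Finset.sum_eq_zero, zero_div]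
    intro k _
    exact Finset.prod_eq_zero (Finset.mem_univ i)
      (eq_zero_of_outputLaw_eq_zero hp0 hB0 (hc w k i) hi)
  · simpa only [hQ] using hleak

end Wiretap

/-! ### Time sharing -/

section TimeSharing

variable {𝒳 𝒴 𝒵 : Type*} {n : ℕ}

/-- Splitting a block of length `n + n` into its two halves. -/
def splitBlock (𝒳 : Type*) (n : ℕ) : (Fin (n + n) → 𝒳) ≃ (Fin n → 𝒳) × (Fin n → 𝒳) :=
  (Fin.appendEquiv n n).symm

theorem sum_splitBlock [Fintype 𝒳] (F : (Fin n → 𝒳) → (Fin n → 𝒳) → ℝ) :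
    ∑ x, F (splitBlock 𝒳 n x).1 (splitBlock 𝒳 n x).2 = ∑ a, ∑ b, F a b := by
  rw [(splitBlock 𝒳 n).sum_comp (fun z => F z.1 z.2), Fintype.sum_prod_type]

variable [Fintype 𝒳] [Fintype 𝒴] [Fintype 𝒵]

omit [Fintype 𝒳] in
theorem blockChannel_split (W : 𝒳 → stdSimplex ℝ (𝒴 × 𝒵)) (x : Fin (n + n) → 𝒳)
    (y : Fin (n + n) → 𝒴) (z : Fin (n + n) → 𝒵) : blockChannel W x y z =
      blockChannel W (splitBlock 𝒳 n x).1 (splitBlock 𝒴 n y).1 (splitBlock 𝒵 n z).1 *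
      blockChannel W (splitBlock 𝒳 n x).2 (splitBlock 𝒴 n y).2 (splitBlock 𝒵 n z).2 := by
  simp only [blockChannel, Fin.prod_univ_add]
  rfl

/-- The code that sends the first message in the first half of the block and the second message in
the second half. -/
def timeShare {M₁ M₂ : ℕ} (E₁ : Fin M₁ → stdSimplex ℝ (Fin n → 𝒳))
    (E₂ : Fin M₂ → stdSimplex ℝ (Fin n → 𝒳)) (dec₁ : (Fin n → 𝒴) → Fin M₁)
    (dec₂ : (Fin n → 𝒵) → Fin M₂) : Code 𝒳 𝒴 𝒵 M₁ M₂ (n + n) where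
  enc w₁ w₂ := ⟨fun x => E₁ w₁ (splitBlock 𝒳 n x).1 * E₂ w₂ (splitBlock 𝒳 n x).2,
    fun x => mul_nonneg ((E₁ w₁).2.1 _) ((E₂ w₂).2.1 _), by
      rw [sum_splitBlock (fun a b => E₁ w₁ a * E₂ w₂ b)]
      have h₁ : ∑ a, E₁ w₁ a = 1 := (E₁ w₁).2.2
      have h₂ : ∑ a, E₂ w₂ a = 1 := (E₂ w₂).2.2
      simp only [← Finset.mul_sum, h₂, mul_one, h₁]⟩
  dec₁ y := dec₁ (splitBlock 𝒴 n y).1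
  dec₂ z := dec₂ (splitBlock 𝒵 n z).2

variable {M₁ M₂ : ℕ} (W : 𝒳 → stdSimplex ℝ (𝒴 × 𝒵)) (E₁ : Fin M₁ → stdSimplex ℝ (Fin n → 𝒳))
  (E₂ : Fin M₂ → stdSimplex ℝ (Fin n → 𝒳)) (dec₁ : (Fin n → 𝒴) → Fin M₁)
  (dec₂ : (Fin n → 𝒵) → Fin M₂)

theorem outputProb_timeShare (w₁ : Fin M₁) (w₂ : Fin M₂) (y : Fin (n + n) → 𝒴)
    (z : Fin (n + n) → 𝒵) : outputProb W (timeShare E₁ E₂ dec₁ dec₂) w₁ w₂ y z =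
      blockOutput W (E₁ w₁) (splitBlock 𝒴 n y).1 (splitBlock 𝒵 n z).1 *
      blockOutput W (E₂ w₂) (splitBlock 𝒴 n y).2 (splitBlock 𝒵 n z).2 := by
  simp only [outputProb, blockChannel_split]
  rw [blockOutput, blockOutput, Finset.sum_mul_sum, ← sum_splitBlock]
  refine Finset.sum_congr rfl fun x _ => ?_
  rw [mul_mul_mul_comm]
  rfl

theorem errorProb₁_timeShare (hM₂ : 0 < M₂) : errorProb₁ W (timeShare E₁ E₂ dec₁ dec₂) =
    (∑ w, ∑ y, if dec₁ y ≠ w then ∑ z, blockOutput W (E₁ w) y z else 0) / M₁ := by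
  have hM₂' : (M₂ : ℝ) ≠ 0 := by exact_mod_cast hM₂.ne'
  have h : ∀ w₁ w₂, (∑ y, ∑ z, if (timeShare E₁ E₂ dec₁ dec₂).dec₁ y ≠ w₁ then
      outputProb W (timeShare E₁ E₂ dec₁ dec₂) w₁ w₂ y z else 0) =
      ∑ y, if dec₁ y ≠ w₁ then ∑ z, blockOutput W (E₁ w₁) y z else 0 := by
    intro w₁ w₂
    simp only [outputProb_timeShare]
    have h1 : ∀ y, (∑ z, if (timeShare E₁ E₂ dec₁ dec₂).dec₁ y ≠ w₁ then
        blockOutput W (E₁ w₁) (splitBlock 𝒴 n y).1 (splitBlock 𝒵 n z).1 *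
        blockOutput W (E₂ w₂) (splitBlock 𝒴 n y).2 (splitBlock 𝒵 n z).2 else 0) =
        (if dec₁ (splitBlock 𝒴 n y).1 ≠ w₁ then
          ∑ z, blockOutput W (E₁ w₁) (splitBlock 𝒴 n y).1 z else 0) *
        ∑ z, blockOutput W (E₂ w₂) (splitBlock 𝒴 n y).2 z := by
      intro y
      change (∑ z, if dec₁ (splitBlock 𝒴 n y).1 ≠ w₁ then _ else _) = _
      split_ifs with h
      · rw [sum_splitBlock (fun a b => blockOutput W (E₁ w₁) (splitBlock 𝒴 n y).1 a *
          blockOutput W (E₂ w₂) (splitBlock 𝒴 n y).2 b), Finset.sum_mul_sum]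
      · simp
    simp only [h1]
    rw [sum_splitBlock (fun a b => (if dec₁ a ≠ w₁ then ∑ z, blockOutput W (E₁ w₁) a z else 0) *
      ∑ z, blockOutput W (E₂ w₂) b z), ← Finset.sum_mul_sum, sum_blockOutput, mul_one]
  simp only [errorProb₁, h, Finset.sum_const, Finset.card_univ, Fintype.card_fin, nsmul_eq_mul,
    Finset.sum_div]
  refine Finset.sum_congr rfl fun w _ => ?_
  rw [← Finset.sum_div]
  field_simp

theorem errorProb₂_timeShare (hM₁ : 0 < M₁) : errorProb₂ W (timeShare E₁ E₂ dec₁ dec₂) =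
    (∑ w, ∑ z, if dec₂ z ≠ w then ∑ y, blockOutput W (E₂ w) y z else 0) / M₂ := by
  have hM₁' : (M₁ : ℝ) ≠ 0 := by exact_mod_cast hM₁.ne'
  have h : ∀ w₁ w₂, (∑ y, ∑ z, if (timeShare E₁ E₂ dec₁ dec₂).dec₂ z ≠ w₂ then
      outputProb W (timeShare E₁ E₂ dec₁ dec₂) w₁ w₂ y z else 0) =
      ∑ z, if dec₂ z ≠ w₂ then ∑ y, blockOutput W (E₂ w₂) y z else 0 := by
    intro w₁ w₂
    rw [Finset.sum_comm]
    simp only [outputProb_timeShare]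
    have h1 : ∀ z, (∑ y, if (timeShare E₁ E₂ dec₁ dec₂).dec₂ z ≠ w₂ then
        blockOutput W (E₁ w₁) (splitBlock 𝒴 n y).1 (splitBlock 𝒵 n z).1 *
        blockOutput W (E₂ w₂) (splitBlock 𝒴 n y).2 (splitBlock 𝒵 n z).2 else 0) =
        (∑ y, blockOutput W (E₁ w₁) y (splitBlock 𝒵 n z).1) *
        (if dec₂ (splitBlock 𝒵 n z).2 ≠ w₂ then
          ∑ y, blockOutput W (E₂ w₂) y (splitBlock 𝒵 n z).2 else 0) := by
      intro z
      change (∑ y, if dec₂ (splitBlock 𝒵 n z).2 ≠ w₂ then _ else _) = _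
      split_ifs with h
      · rw [sum_splitBlock (fun a b => blockOutput W (E₁ w₁) a (splitBlock 𝒵 n z).1 *
          blockOutput W (E₂ w₂) b (splitBlock 𝒵 n z).2), Finset.sum_mul_sum]
      · simp
    simp only [h1]
    rw [sum_splitBlock (fun a b => (∑ y, blockOutput W (E₁ w₁) y a) *
      (if dec₂ b ≠ w₂ then ∑ y, blockOutput W (E₂ w₂) y b else 0)), ← Finset.sum_mul_sum,
      Finset.sum_comm, sum_blockOutput, one_mul]
  simp only [errorProb₂, h]
  rw [Finset.sum_comm, Finset.sum_div]
  refine Finset.sum_congr rfl fun w _ => ?_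
  simp only [Finset.sum_const, Finset.card_univ, Fintype.card_fin, nsmul_eq_mul]
  field_simp

theorem law_codeDist_fst (c : Code 𝒳 𝒴 𝒵 M₁ M₂ n) (w : Fin M₁) (z : Fin n → 𝒵) :
    law (codeDist W c) (fun ω => (ω.1.1, ω.2.2)) (w, z) =
      ∑ w₂, ∑ y, 1 / ((M₁ : ℝ) * M₂) * outputProb W c w w₂ y z := by
  classical
  simp only [law, codeDist, Fintype.sum_prod_type, Prod.mk.injEq, ite_and]
  simp

theorem law_codeDist_snd (c : Code 𝒳 𝒴 𝒵 M₁ M₂ n) (w : Fin M₂) (y : Fin n → 𝒴) :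
    law (codeDist W c) (fun ω => (ω.1.2, ω.2.1)) (w, y) =
      ∑ w₁, ∑ z, 1 / ((M₁ : ℝ) * M₂) * outputProb W c w₁ w y z := by
  classical
  simp only [law, codeDist, Fintype.sum_prod_type, Prod.mk.injEq, ite_and]
  simp

variable {W E₁ E₂}

/-- The second half of receiver 2's output depends only on the other message. It therefore plays the
independent part `G`, the output law of `E₂` averaged over its messages. -/
theorem equivocation₁_timeShare_ge (hM₁ : 0 < M₁) (hM₂ : 0 < M₂) {r : (Fin n → 𝒵) → ℝ}
    (hr0 : ∀ z, 0 ≤ r z) (hr : ∑ z, r z ≤ 1)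
    (hrQ : ∀ w z, r z = 0 → ∑ y, blockOutput W (E₁ w) y z = 0) :
    (Real.log M₁ - (∑ w, ∑ z, (∑ y, blockOutput W (E₁ w) y z) *
      Real.log ((∑ y, blockOutput W (E₁ w) y z) / r z)) / M₁) / Real.log 2 ≤
      equivocation₁ W (timeShare E₁ E₂ dec₁ dec₂) := by
  have hM₂' : (M₂ : ℝ) ≠ 0 := by exact_mod_cast hM₂.ne'
  refine condEntropy_ge_of_law_eq hM₁ (splitBlock 𝒵 n)
    (Q := fun w z => ∑ y, blockOutput W (E₁ w) y z)
    (G := fun z => (∑ w, ∑ y, blockOutput W (E₂ w) y z) / M₂)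
    (fun w z => ?_) (fun w z => Finset.sum_nonneg fun _ _ => blockOutput_nonneg _ _ _ _)
    (fun w => by rw [Finset.sum_comm, sum_blockOutput])
    (fun z => div_nonneg (Finset.sum_nonneg fun _ _ => Finset.sum_nonneg fun _ _ =>
      blockOutput_nonneg _ _ _ _) (Nat.cast_nonneg _)) ?_ hr0 hr hrQ
  · rw [law_codeDist_fst]
    simp only [outputProb_timeShare, ← Finset.mul_sum]
    have h1 : ∀ w₂, ∑ y, blockOutput W (E₁ w) (splitBlock 𝒴 n y).1 (splitBlock 𝒵 n z).1 *
        blockOutput W (E₂ w₂) (splitBlock 𝒴 n y).2 (splitBlock 𝒵 n z).2 =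
        (∑ y, blockOutput W (E₁ w) y (splitBlock 𝒵 n z).1) *
        ∑ y, blockOutput W (E₂ w₂) y (splitBlock 𝒵 n z).2 := fun w₂ => by
      rw [sum_splitBlock (fun a b => blockOutput W (E₁ w) a (splitBlock 𝒵 n z).1 *
          blockOutput W (E₂ w₂) b (splitBlock 𝒵 n z).2), Finset.sum_mul_sum]
    simp only [h1, ← Finset.mul_sum]
    field_simp
  · rw [← Finset.sum_div, Finset.sum_comm]
    have h2 : ∀ w, ∑ z, ∑ y, blockOutput W (E₂ w) y z = 1 := fun w => by
      rw [Finset.sum_comm, sum_blockOutput]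
    simp [h2, hM₂']

theorem equivocation₂_timeShare_ge (hM₁ : 0 < M₁) (hM₂ : 0 < M₂) {r : (Fin n → 𝒴) → ℝ}
    (hr0 : ∀ y, 0 ≤ r y) (hr : ∑ y, r y ≤ 1)
    (hrQ : ∀ w y, r y = 0 → ∑ z, blockOutput W (E₂ w) y z = 0) :
    (Real.log M₂ - (∑ w, ∑ y, (∑ z, blockOutput W (E₂ w) y z) *
      Real.log ((∑ z, blockOutput W (E₂ w) y z) / r y)) / M₂) / Real.log 2 ≤
      equivocation₂ W (timeShare E₁ E₂ dec₁ dec₂) := by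
  have hM₁' : (M₁ : ℝ) ≠ 0 := by exact_mod_cast hM₁.ne'
  -- Here the informative half is the second one, hence the exchange of the halves.
  refine condEntropy_ge_of_law_eq hM₂ ((splitBlock 𝒴 n).trans (Equiv.prodComm _ _))
    (Q := fun w y => ∑ z, blockOutput W (E₂ w) y z)
    (G := fun y => (∑ w, ∑ z, blockOutput W (E₁ w) y z) / M₁)
    (fun w y => ?_) (fun w y => Finset.sum_nonneg fun _ _ => blockOutput_nonneg _ _ _ _)
    (fun w => sum_blockOutput _ _)
    (fun y => div_nonneg (Finset.sum_nonneg fun _ _ => Finset.sum_nonneg fun _ _ =>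
      blockOutput_nonneg _ _ _ _) (Nat.cast_nonneg _)) ?_ hr0 hr hrQ
  · rw [law_codeDist_snd]
    simp only [outputProb_timeShare, ← Finset.mul_sum]
    have h1 : ∀ w₁, ∑ z, blockOutput W (E₁ w₁) (splitBlock 𝒴 n y).1 (splitBlock 𝒵 n z).1 *
        blockOutput W (E₂ w) (splitBlock 𝒴 n y).2 (splitBlock 𝒵 n z).2 =
        (∑ z, blockOutput W (E₁ w₁) (splitBlock 𝒴 n y).1 z) *
        ∑ z, blockOutput W (E₂ w) (splitBlock 𝒴 n y).2 z := fun w₁ => by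
      rw [sum_splitBlock (fun a b => blockOutput W (E₁ w₁) (splitBlock 𝒴 n y).1 a *
          blockOutput W (E₂ w) (splitBlock 𝒴 n y).2 b), Finset.sum_mul_sum]
    simp only [h1, ← Finset.sum_mul, Equiv.trans_apply, Equiv.prodComm_apply, Prod.fst_swap,
      Prod.snd_swap]
    field_simp
  · rw [← Finset.sum_div, Finset.sum_comm]
    simp [sum_blockOutput, hM₁']

/-- The channel with the two outputs exchanged. -/
def swapChannel (W : 𝒳 → stdSimplex ℝ (𝒴 × 𝒵)) (x : 𝒳) : stdSimplex ℝ (𝒵 × 𝒴) :=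
  ⟨fun z => W x z.swap, fun z => (W x).2.1 _, by
    exact ((Equiv.prodComm 𝒵 𝒴).sum_comp (fun z => W x z)).trans (W x).2.2⟩

theorem two_rpow_eq_exp (a : ℝ) : (2 : ℝ) ^ a = Real.exp (a * Real.log 2) := by
  rw [Real.rpow_def_of_pos two_pos, mul_comm]

/-- Two wiretap codes, one for either receiver, combine to positive secrecy rates for both. -/
theorem exists_achievable (W : 𝒳 → stdSimplex ℝ (𝒴 × 𝒵)) {𝒱 𝒱' : Type*} [Fintype 𝒱]
    [Fintype 𝒱'] {p : 𝒱 → ℝ} (hp0 : ∀ v, 0 ≤ p v) (hp : ∑ v, p v = 1)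
    (q : 𝒱 → stdSimplex ℝ 𝒳) {p' : 𝒱' → ℝ} (hp0' : ∀ v, 0 ≤ p' v) (hp' : ∑ v, p' v = 1)
    (q' : 𝒱' → stdSimplex ℝ 𝒳)
    (h : channelInfo p (fun v z => ∑ y, ∑ x, q v x * W x (y, z)) <
      channelInfo p (fun v y => ∑ z, ∑ x, q v x * W x (y, z)))
    (h' : channelInfo p' (fun v y => ∑ z, ∑ x, q' v x * W x (y, z)) <
      channelInfo p' (fun v z => ∑ y, ∑ x, q' v x * W x (y, z))) :
    ∃ R₁ R₂ : ℝ, 0 < R₁ ∧ 0 < R₂ ∧ Achievable W R₁ R₂ := by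
  obtain ⟨R₁, hR₁, h₁⟩ := exists_wiretap_code W hp0 hp q h
  obtain ⟨R₂, hR₂, h₂⟩ := exists_wiretap_code (swapChannel W) hp0' hp' q' h'
  have hlog : 0 < Real.log 2 := Real.log_pos one_lt_two
  have hlog1 : Real.log 2 ≤ 1 := by linarith [Real.log_two_lt_d9]
  -- The factor `log 2` converts nats to bits; the 2 accounts for using only half of the block.
  refine ⟨R₁ / (2 * Real.log 2), R₂ / (2 * Real.log 2), by positivity, by positivity,
    fun ε hε => ?_⟩
  obtain ⟨N₁, hN₁⟩ := h₁ (ε * Real.log 2) (by positivity)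
  obtain ⟨N₂, hN₂⟩ := h₂ (ε * Real.log 2) (by positivity)
  -- Both codes exist at every large length, so the two halves can be given a common length.
  obtain ⟨n, hn, hn₁, hn₂⟩ : ∃ n : ℕ, 0 < n ∧ N₁ ≤ n ∧ N₂ ≤ n :=
    ⟨N₁ + N₂ + 1, by omega, by omega, by omega⟩
  obtain ⟨M₁, E₁, dec₁, r₁, hM₁, hMR₁, herr₁, hr₁, hrs₁, hrQ₁, hleak₁⟩ := hN₁ n hn₁
  obtain ⟨M₂, E₂, dec₂, r₂, hM₂, hMR₂, herr₂, hr₂, hrs₂, hrQ₂, hleak₂⟩ := hN₂ n hn₂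
  have hεle : ε * Real.log 2 ≤ ε := by nlinarith
  have hn' : (1 : ℝ) ≤ n := by exact_mod_cast hn
  have hrate : ∀ R : ℝ, ((n + n : ℕ) : ℝ) * (R / (2 * Real.log 2)) * Real.log 2 = n * R := by
    intro R
    push_cast
    field_simp
    ring
  have hsec : ∀ {R : ℝ} {M : ℕ} {L H : ℝ}, 0 < M → Real.exp (n * R) ≤ M →
      L ≤ ε * Real.log 2 → (Real.log M - L) / Real.log 2 ≤ H →
      ((n + n : ℕ) : ℝ) * (R / (2 * Real.log 2)) - H ≤ ((n + n : ℕ) : ℝ) * ε := by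
    intro R M L H hM hMR hL hH
    have hM' : (0 : ℝ) < M := by exact_mod_cast hM
    have h3 : n * R ≤ Real.log M := (Real.le_log_iff_exp_le hM').2 hMR
    rw [div_le_iff₀ hlog] at hH
    -- The total leakage, not just its rate, is at most `ε` bits.
    have h4 : ((n + n : ℕ) : ℝ) * (R / (2 * Real.log 2)) - H ≤ ε := by
      refine le_of_mul_le_mul_right ?_ hlog
      rw [sub_mul, hrate]
      linarith
    refine h4.trans ?_
    push_cast
    nlinarith
  refine ⟨M₁, M₂, n + n, timeShare E₁ E₂ dec₁ dec₂, by omega, ?_, ?_, max_le ?_ ?_, ?_, ?_⟩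
  · rw [two_rpow_eq_exp, hrate]; exact hMR₁
  · rw [two_rpow_eq_exp, hrate]; exact hMR₂
  · rw [errorProb₁_timeShare W E₁ E₂ dec₁ dec₂ hM₂]
    exact herr₁.trans hεle
  · rw [errorProb₂_timeShare W E₁ E₂ dec₁ dec₂ hM₁]
    exact le_trans herr₂ hεle
  · exact hsec hM₁ hMR₁ hleak₁ (equivocation₁_timeShare_ge dec₁ dec₂ hM₁ hM₂ hr₁ hrs₁ hrQ₁)
  · exact hsec hM₂ hMR₂ hleak₂ (equivocation₂_timeShare_ge dec₁ dec₂ hM₁ hM₂ hr₂ hrs₂ hrQ₂)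

end TimeSharing

/-! ### Eliminating the auxiliary variables -/

section Auxiliary

theorem condEntropy_equiv {Ω A B C : Type*} [Fintype Ω] [Fintype A] [Fintype B] [Fintype C]
    (p : Ω → ℝ) (X : Ω → A) (Y : Ω → B) (e : B ≃ C) :
    condEntropy p X (fun ω => e (Y ω)) = condEntropy p X Y := by
  have h1 : ∀ a b, law p (fun ω => (X ω, e (Y ω))) (a, e b) = law p (fun ω => (X ω, Y ω)) (a, b) :=
    fun a b => Finset.sum_congr rfl fun ω _ => by
      by_cases hX : X ω = a <;> by_cases hY : Y ω = b <;> simp [hX, hY]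
  have h2 : ∀ b, law p (fun ω => e (Y ω)) (e b) = law p Y b :=
    fun b => Finset.sum_congr rfl fun ω _ => by by_cases hY : Y ω = b <;> simp [hY]
  unfold condEntropy
  congr 1
  refine Finset.sum_congr rfl fun a _ => ?_
  rw [← e.sum_comp]
  simp only [h1, h2]

/-- The conditional entropy given an output and `U`, in terms of the mutual informations given the
values of `U`. -/
theorem condEntropy_eq_channelInfo {Ω 𝒰 𝒱 𝒴 : Type*} [Fintype Ω] [Fintype 𝒰] [Fintype 𝒱]
    [Fintype 𝒴] {P : Ω → ℝ} {U : Ω → 𝒰} {V : Ω → 𝒱} {Y : Ω → 𝒴}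
    {c : 𝒰 → ℝ} {p : 𝒰 → 𝒱 → ℝ} {A : 𝒰 → 𝒱 → 𝒴 → ℝ} (hp0 : ∀ u v, 0 ≤ p u v)
    (hA0 : ∀ u v y, 0 ≤ A u v y) (hA : ∀ u v, ∑ y, A u v y = 1)
    (hY : ∀ v y u, law P (fun ω => (V ω, (Y ω, U ω))) (v, (y, u)) = c u * (p u v * A u v y)) :
    condEntropy P V (fun ω => (Y ω, U ω)) = -(∑ u, c u * (channelInfo (p u) (A u) +
      ∑ v, p u v * Real.log (p u v))) / Real.log 2 := by
  rw [condEntropy_eq, Fintype.sum_prod_type_right]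
  congr 2
  refine Finset.sum_congr rfl fun u _ => ?_
  simp only [← sum_law_fst P V (fun ω => (Y ω, U ω)), hY, ← Finset.mul_sum]
  change ∑ y, ∑ v, c u * (p u v * A u v y) *
    Real.log (c u * (p u v * A u v y) / (c u * outputLaw (p u) (A u) y)) = _
  rw [channelInfo, ← Finset.sum_add_distrib, Finset.mul_sum, Finset.sum_comm]
  refine Finset.sum_congr rfl fun v _ => ?_
  -- Writing 1 as the sum of `A u v` brings the entropy term under the sum over `y`, so that the
  -- identity can be checked termwise.
  rw [← mul_add, ← mul_one (Real.log (p u v)), ← hA u v, Finset.mul_sum,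
    ← Finset.sum_add_distrib, Finset.mul_sum, Finset.mul_sum]
  refine Finset.sum_congr rfl fun y _ => ?_
  by_cases hcu : c u = 0
  · simp [hcu]
  by_cases hpu : p u v = 0
  · simp [hpu]
  by_cases hAu : A u v y = 0
  · simp [hAu]
  have hq : outputLaw (p u) (A u) y ≠ 0 := fun h' =>
    hAu (eq_zero_of_outputLaw_eq_zero (hp0 u) (hA0 u) hpu h')
  rw [mul_div_mul_left _ _ hcu, mul_div_assoc, Real.log_mul hpu (div_ne_zero hAu hq)]
  ring

/-- If `H(V | Y, U) < H(V | Z, U)`, then for some value `u` of `U` the conditional law of `V` given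
`U = u` makes `V` more informative about `Y` than about `Z`. -/
theorem exists_channelInfo_lt {Ω 𝒰 𝒱 𝒴 𝒵 : Type*} [Fintype Ω] [Fintype 𝒰] [Fintype 𝒱]
    [Fintype 𝒴] [Fintype 𝒵] {P : Ω → ℝ} {U : Ω → 𝒰} {V : Ω → 𝒱} {Y : Ω → 𝒴} {Z : Ω → 𝒵}
    {c : 𝒰 → ℝ} {p : 𝒰 → 𝒱 → ℝ} {A : 𝒰 → 𝒱 → 𝒴 → ℝ} {B : 𝒰 → 𝒱 → 𝒵 → ℝ}
    (hc : ∀ u, 0 ≤ c u) (hp0 : ∀ u v, 0 ≤ p u v) (hA0 : ∀ u v y, 0 ≤ A u v y)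
    (hA : ∀ u v, ∑ y, A u v y = 1) (hB0 : ∀ u v z, 0 ≤ B u v z) (hB : ∀ u v, ∑ z, B u v z = 1)
    (hY : ∀ v y u, law P (fun ω => (V ω, (Y ω, U ω))) (v, (y, u)) = c u * (p u v * A u v y))
    (hZ : ∀ v z u, law P (fun ω => (V ω, (Z ω, U ω))) (v, (z, u)) = c u * (p u v * B u v z))
    (h : condEntropy P V (fun ω => (Y ω, U ω)) < condEntropy P V (fun ω => (Z ω, U ω))) :
    ∃ u, channelInfo (p u) (B u) < channelInfo (p u) (A u) := by
  rw [condEntropy_eq_channelInfo hp0 hA0 hA hY, condEntropy_eq_channelInfo hp0 hB0 hB hZ,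
    div_lt_div_iff_of_pos_right (Real.log_pos one_lt_two), neg_lt_neg_iff] at h
  obtain ⟨u, -, hu⟩ := Finset.exists_lt_of_sum_lt h
  refine ⟨u, ?_⟩
  -- After cancelling the weight `c u`, the term `∑ v, p u v * log (p u v)` is common to both sides.
  have := lt_of_mul_lt_mul_left hu (hc u)
  linarith

/-- Averaging the input law over the second of two auxiliary variables. -/
theorem exists_conditional_input {𝒱 𝒱' 𝒳 : Type*} [Fintype 𝒱] [Fintype 𝒱'] [Fintype 𝒳]
    (π : stdSimplex ℝ (𝒱 × 𝒱')) (pX : 𝒱 × 𝒱' → stdSimplex ℝ 𝒳) :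
    ∃ q : 𝒱 → stdSimplex ℝ 𝒳, ∀ v x,
      (∑ v', π (v, v')) * q v x = ∑ v', π (v, v') * pX (v, v') x := by
  have h : ∀ v, ∃ q : stdSimplex ℝ 𝒳, ∀ x,
      (∑ v', π (v, v')) * q x = ∑ v', π (v, v') * pX (v, v') x := by
    intro v
    by_cases hv : ∑ v', π (v, v') = 0
    · have hv' := (Finset.sum_eq_zero_iff_of_nonneg (fun v' _ => π.2.1 (v, v'))).1 hv
      -- For `v` of probability zero any input law will do; a point of the support of `π` guarantees
      -- that one exists.
      obtain ⟨i, -, -⟩ : ∃ i ∈ (Finset.univ : Finset (𝒱 × 𝒱')), π i ≠ 0 :=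
        Finset.exists_ne_zero_of_sum_ne_zero (by
          rw [show ∑ i, π i = 1 from π.2.2]; exact one_ne_zero)
      refine ⟨pX i, fun x => ?_⟩
      rw [hv, zero_mul, Finset.sum_eq_zero]
      intro v' hm
      rw [show π (v, v') = 0 from hv' v' hm, zero_mul]
    · refine ⟨⟨fun x => (∑ v', π (v, v') * pX (v, v') x) / ∑ v', π (v, v'), fun x => ?_, ?_⟩,
        fun x => mul_div_cancel₀ _ hv⟩
      · exact div_nonneg (Finset.sum_nonneg fun v' _ => mul_nonneg (π.2.1 _) ((pX _).2.1 _))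
          (Finset.sum_nonneg fun v' _ => π.2.1 _)
      · rw [← Finset.sum_div, Finset.sum_comm]
        simp_rw [← Finset.mul_sum]
        rw [show ∑ v', π (v, v') * ∑ x, pX (v, v') x = ∑ v', π (v, v') from
          Finset.sum_congr rfl fun v' _ => by
            rw [show ∑ x, pX (v, v') x = 1 from (pX (v, v')).2.2, mul_one]]
        exact div_self hv
  choose q hq using h
  exact ⟨q, hq⟩

variable {𝒰 𝒱₁ 𝒱₂ 𝒳 𝒴₁ 𝒴₂ : Type*} [Fintype 𝒰] [Fintype 𝒱₁] [Fintype 𝒱₂]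
  [Fintype 𝒳] [Fintype 𝒴₁] [Fintype 𝒴₂] (P : 𝒰 × 𝒱₁ × 𝒱₂ × 𝒳 × 𝒴₁ × 𝒴₂ → ℝ)

theorem law_V₁_Y₁_U (v : 𝒱₁) (y : 𝒴₁) (u : 𝒰) :
    law P (fun ω => (rvV₁ ω, (rvY₁ ω, rvU ω))) (v, (y, u)) =
      ∑ v', ∑ x, ∑ z, P (u, v, v', x, y, z) := by
  classical
  simp only [law, rvV₁, rvY₁, rvU, Fintype.sum_prod_type, Prod.mk.injEq, ite_and]
  exact (Finset.sum_eq_single u (fun _ _ h => by simp [h]) (by simp)).trans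
    ((Finset.sum_eq_single v (fun _ _ h => by simp [h]) (by simp)).trans
    (Finset.sum_congr rfl fun v' _ => Finset.sum_congr rfl fun x _ =>
    (Finset.sum_eq_single y (fun _ _ h => by simp [h]) (by simp)).trans (by simp)))

theorem law_V₁_Y₂_U (v : 𝒱₁) (z : 𝒴₂) (u : 𝒰) :
    law P (fun ω => (rvV₁ ω, (rvY₂ ω, rvU ω))) (v, (z, u)) =
      ∑ v', ∑ x, ∑ y, P (u, v, v', x, y, z) := by
  classical
  simp only [law, rvV₁, rvY₂, rvU, Fintype.sum_prod_type, Prod.mk.injEq, ite_and]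
  exact (Finset.sum_eq_single u (fun _ _ h => by simp [h]) (by simp)).trans
    ((Finset.sum_eq_single v (fun _ _ h => by simp [h]) (by simp)).trans
    (Finset.sum_congr rfl fun v' _ => Finset.sum_congr rfl fun x _ =>
    Finset.sum_congr rfl fun y _ => by simp))

theorem law_V₂_Y₁_U (v : 𝒱₂) (y : 𝒴₁) (u : 𝒰) :
    law P (fun ω => (rvV₂ ω, (rvY₁ ω, rvU ω))) (v, (y, u)) =
      ∑ v', ∑ x, ∑ z, P (u, v', v, x, y, z) := by
  classical
  simp only [law, rvV₂, rvY₁, rvU, Fintype.sum_prod_type, Prod.mk.injEq, ite_and]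
  exact (Finset.sum_eq_single u (fun _ _ h => by simp [h]) (by simp)).trans
    (Finset.sum_congr rfl fun v' _ =>
    (Finset.sum_eq_single v (fun _ _ h => by simp [h]) (by simp)).trans
    (Finset.sum_congr rfl fun x _ =>
    (Finset.sum_eq_single y (fun _ _ h => by simp [h]) (by simp)).trans (by simp)))

theorem law_V₂_Y₂_U (v : 𝒱₂) (z : 𝒴₂) (u : 𝒰) :
    law P (fun ω => (rvV₂ ω, (rvY₂ ω, rvU ω))) (v, (z, u)) =
      ∑ v', ∑ x, ∑ y, P (u, v', v, x, y, z) := by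
  classical
  simp only [law, rvV₂, rvY₂, rvU, Fintype.sum_prod_type, Prod.mk.injEq, ite_and]
  exact (Finset.sum_eq_single u (fun _ _ h => by simp [h]) (by simp)).trans
    (Finset.sum_congr rfl fun v' _ =>
    (Finset.sum_eq_single v (fun _ _ h => by simp [h]) (by simp)).trans
    (Finset.sum_congr rfl fun x _ =>
    Finset.sum_congr rfl fun y _ => by simp))

/-- Positivity of the secrecy condition without the second auxiliary variable. -/
theorem exists_input_channelInfo_lt {Ω 𝒰 𝒱 𝒱' 𝒳 𝒴 𝒵 : Type*} [Fintype Ω] [Fintype 𝒰] [Fintype 𝒱]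
    [Fintype 𝒱'] [Fintype 𝒳] [Fintype 𝒴] [Fintype 𝒵] {P : Ω → ℝ} (hP0 : ∀ ω, 0 ≤ P ω)
    {U : Ω → 𝒰} {V : Ω → 𝒱} {V' : Ω → 𝒱'} {Y : Ω → 𝒴} {Z : Ω → 𝒵}
    (W : 𝒳 → stdSimplex ℝ (𝒴 × 𝒵)) (pU : stdSimplex ℝ 𝒰) (pV : 𝒰 → stdSimplex ℝ (𝒱 × 𝒱'))
    (pX : 𝒱 × 𝒱' → stdSimplex ℝ 𝒳)
    (hY : ∀ v y u, law P (fun ω => (V ω, (Y ω, U ω))) (v, (y, u)) =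
      ∑ v', ∑ x, ∑ z, pU u * pV u (v, v') * pX (v, v') x * W x (y, z))
    (hZ : ∀ v z u, law P (fun ω => (V ω, (Z ω, U ω))) (v, (z, u)) =
      ∑ v', ∑ x, ∑ y, pU u * pV u (v, v') * pX (v, v') x * W x (y, z))
    (h : condMutualInfo P V Y U > condMutualInfo P V (fun ω => (Z ω, V' ω)) U) :
    ∃ (p : 𝒱 → ℝ) (q : 𝒱 → stdSimplex ℝ 𝒳), (∀ v, 0 ≤ p v) ∧ ∑ v, p v = 1 ∧
      channelInfo p (fun v z => ∑ y, ∑ x, q v x * W x (y, z)) <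
        channelInfo p (fun v y => ∑ z, ∑ x, q v x * W x (y, z)) := by
  choose q hq using fun u => exists_conditional_input (pV u) pX
  have hmono : condEntropy P V (fun ω => ((Z ω, V' ω), U ω)) ≤
      condEntropy P V (fun ω => (Z ω, U ω)) := by
    refine le_trans (le_of_eq ?_) (condEntropy_pair_le hP0 V (fun ω => (Z ω, U ω)) V')
    exact condEntropy_equiv P V (fun ω => (V' ω, (Z ω, U ω)))
      ((Equiv.prodAssoc 𝒱' 𝒵 𝒰).symm.trans ((Equiv.prodComm 𝒱' 𝒵).prodCongr (Equiv.refl 𝒰)))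
  -- Both mutual informations contain the same term H(V | U), so the hypothesis compares only the
  -- entropies given the outputs.
  have hlt : condEntropy P V (fun ω => (Y ω, U ω)) < condEntropy P V (fun ω => (Z ω, U ω)) := by
    simp only [condMutualInfo] at h
    linarith
  have hnn : ∀ u v x y z, 0 ≤ q u v x * W x (y, z) := fun u v x y z =>
    mul_nonneg ((q u v).2.1 x) ((W x).2.1 _)
  have hsum : ∀ u v, ∑ y, ∑ z, ∑ x, q u v x * W x (y, z) = 1 := by
    intro u v
    rw [← Fintype.sum_prod_type' (fun y z => ∑ x, q u v x * W x (y, z)), Finset.sum_comm]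
    simp_rw [← Finset.mul_sum]
    calc ∑ x, q u v x * ∑ i, W x i = ∑ x, q u v x := Finset.sum_congr rfl fun x _ => by
          rw [show ∑ i, W x i = 1 from (W x).2.2, mul_one]
      _ = 1 := (q u v).2.2
  obtain ⟨u, hu⟩ := exists_channelInfo_lt (P := P) (U := U) (V := V) (Y := Y) (Z := Z)
    (c := fun u => pU u) (p := fun u v => ∑ v', pV u (v, v'))
    (A := fun u v y => ∑ z, ∑ x, q u v x * W x (y, z))
    (B := fun u v z => ∑ y, ∑ x, q u v x * W x (y, z))
    (fun u => pU.2.1 u) (fun u v => Finset.sum_nonneg fun v' _ => (pV u).2.1 _)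
    (fun u v y => Finset.sum_nonneg fun z _ => Finset.sum_nonneg fun x _ => hnn u v x y z) hsum
    (fun u v z => Finset.sum_nonneg fun y _ => Finset.sum_nonneg fun x _ => hnn u v x y z)
    (fun u v => by rw [Finset.sum_comm]; exact hsum u v)
    (fun v y u => by
      rw [hY, Finset.sum_comm (s := (Finset.univ : Finset 𝒵)), Finset.mul_sum,
        Finset.mul_sum, Finset.sum_comm]
      refine Finset.sum_congr rfl fun x _ => ?_
      simp_rw [← Finset.mul_sum]
      rw [← mul_assoc (∑ v', pV u (v, v')), hq, Finset.sum_mul, Finset.mul_sum]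
      exact Finset.sum_congr rfl fun v' _ => by ring)
    (fun v z u => by
      rw [hZ, Finset.sum_comm (s := (Finset.univ : Finset 𝒴)), Finset.mul_sum,
        Finset.mul_sum, Finset.sum_comm]
      refine Finset.sum_congr rfl fun x _ => ?_
      simp_rw [← Finset.mul_sum]
      rw [← mul_assoc (∑ v', pV u (v, v')), hq, Finset.sum_mul, Finset.mul_sum]
      exact Finset.sum_congr rfl fun v' _ => by ring) hlt
  refine ⟨_, q u, fun v => Finset.sum_nonneg fun v' _ => (pV u).2.1 (v, v'), ?_, hu⟩
  exact (Fintype.sum_prod_type' (fun v v' => pV u (v, v'))).symm.trans (pV u).2.2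

end Auxiliary

end BCCM

theorem mainTheorem6 {𝒰 𝒱₁ 𝒱₂ 𝒳 𝒴₁ 𝒴₂ : Type*} [Fintype 𝒰] [Fintype 𝒱₁] [Fintype 𝒱₂]
    [Fintype 𝒳] [Fintype 𝒴₁] [Fintype 𝒴₂]
    (W : 𝒳 → stdSimplex ℝ (𝒴₁ × 𝒴₂))
    (P : 𝒰 × 𝒱₁ × 𝒱₂ × 𝒳 × 𝒴₁ × 𝒴₂ → ℝ) (hP : P ∈ BCCM.piBC W)
    (h₁ : BCCM.condMutualInfo P BCCM.rvV₁ BCCM.rvY₁ BCCM.rvU >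
      BCCM.condMutualInfo P BCCM.rvV₁ (fun ω => (BCCM.rvY₂ ω, BCCM.rvV₂ ω)) BCCM.rvU)
    (h₂ : BCCM.condMutualInfo P BCCM.rvV₂ BCCM.rvY₂ BCCM.rvU >
      BCCM.condMutualInfo P BCCM.rvV₂ (fun ω => (BCCM.rvY₁ ω, BCCM.rvV₁ ω)) BCCM.rvU) :
    ∃ R₁ R₂ : ℝ, 0 < R₁ ∧ 0 < R₂ ∧ BCCM.Achievable W R₁ R₂ := by
  obtain ⟨pU, pV, pX, hfac⟩ := hP
  have hP0 : ∀ ω, 0 ≤ P ω := by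
    rintro ⟨u, v₁, v₂, x, y₁, y₂⟩
    rw [hfac]
    exact mul_nonneg (mul_nonneg (mul_nonneg (pU.2.1 u) ((pV u).2.1 _)) ((pX _).2.1 x))
      ((W x).2.1 _)
  obtain ⟨p, q, hp0, hp, h⟩ := BCCM.exists_input_channelInfo_lt hP0 W pU pV pX
    (fun v y u => by rw [BCCM.law_V₁_Y₁_U]; simp only [hfac])
    (fun v z u => by rw [BCCM.law_V₁_Y₂_U]; simp only [hfac]) h₁
  -- For the second receiver the outputs and the auxiliary variables are both exchanged;
  -- `swapChannel` applied to the kernel `pV` does the latter.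
  obtain ⟨p', q', hp0', hp', h'⟩ := BCCM.exists_input_channelInfo_lt hP0 (BCCM.swapChannel W) pU
    (fun u => BCCM.swapChannel pV u) (fun v => pX v.swap)
    (fun v z u => by rw [BCCM.law_V₂_Y₂_U]; simp only [hfac]; rfl)
    (fun v y u => by rw [BCCM.law_V₂_Y₁_U]; simp only [hfac]; rfl) h₂
  exact BCCM.exists_achievable W hp0 hp q hp0' hp' q' h h'
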